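/- Let $k\ge 1$ and let $p_1\ge p_2\ge\dots\ge p_k>0$ with $\sum_i p_i=1$. An allocation (strategy) $\mathbf n=\langle n_1,\dots,n_k\rangle$ of $n=\sum_i n_i$ counters places $n_i\ge 0$ counters in box $i$. At times $t=1,2,\dots$ a random box is drawn independently, box $i$ with probability $p_i$, and one counter is removed from the drawn box if it contains one. Let $T_{\mathbf n}$ be the time at which the last counter is removed ($T_{\mathbf n}=0$ if $n=0$). The payoff of $\mathbf n$ against $\mathbf m$ is $V(\mathbf n,\mathbf m)=\Pr(T_{\mathbf n}<T_{\mathbf m})-\Pr(T_{\mathbf m}<T_{\mathbf n})$. It is written $V_c$ when both players use the same sequence of draws (common throw) and $V_s$ when they use independent sequences with the same box probabilities (separate throw). (1) $\mathbb E(T_{\mathbf n})<\infty$ for every $\mathbf n$. (2) Let $i<j$ and $n_i<n_j$, and let $\mathbf n'$ be obtained from $\mathbf n$ by moving one counter from box $j$ to the likelier box $i$. Then $\mathbb E(T_{\mathbf n'})\le\mathbb E(T_{\mathbf n})$, $V_c(\mathbf n',\mathbf n)\ge 0$, $V_s(\mathbf n',\mathbf n)\ge 0$, and $V_s(\mathbf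 n',\mathbf m)\ge V_s(\mathbf n,\mathbf m)$ for every allocation $\mathbf m$ of the same number of counters. Each of these inequalities is strict if and only if $p_i>p_j$ or $n_j\ge n_i+2$. (In the remaining case, $p_i=p_j$ and $n_j=n_i+1$, the transfer just interchanges two equally likely boxes.) (3) Hence only restricted partitions $n_1\ge n_2\ge\dots\ge n_k$ need be considered, in the following sense. - For every $\mathbf n$ there is a nonincreasing $\mathbf n'$ with the same number of counters such that $\mathbb E(T_{\mathbf n'})\le \mathbb E(T_{\mathbf n})$ and $V_s(\mathbf n',\mathbf m)\ge V_s(\mathbf n,\mathbf m)$ for every allocation $\mathbf m$ of the same number of counters. - For every number of counters, the minimum expected time to removal is attained by a nonincreasing allocation, and every minimizer satisfies $n_i\ge n_j$ whenever $p_i>p_j$. - In the common throw game and in the separate throw game, every pure optimal strategy $\mathbf n$ (that is, $(\mathbf n,\mathbf n)$ is a saddle point of the payoff) satisfies $n_i\ge n_j$ whenever $p_i>p_j$, and if a pure optimal strategy exists then there is a nonincreasing one. (4) Take two boxes with probabilities $p$ and $1-p$, $0<p<1$, and integers $a,b\ge0$. Let player I play $\langle a+1,b\rangle$ and player II play $\langle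 a,b+1\rangle$ with common throws, and let $M=T_{\langle a,b+1\rangle}-T_{\langle a+1,b\rangle}$ be player I's margin of victory. Then, almost surely, both times are finite and $M\ne0$; moreover $\Pr(M>0)=I_p(a+1,b+1)$, $M$ is integrable, and $$\mathbb E(M)=\frac{I_p(a+1,b+1)}{1-p}-\frac{1-I_p(a+1,b+1)}{p},$$ where $I_x(\alpha,\beta)=\frac{\Gamma(\alpha+\beta)}{\Gamma(\alpha)\Gamma(\beta)}\int_0^x t^{\alpha-1}(1-t)^{\beta-1}\,dt$. If $p\ge\frac12$ and $a\le b$, not both with equality, then $\mathbb E(M)>0$. -/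

import Mathlib

open MeasureTheory
open scoped ENNReal

namespace LiabilityGame

variable {k : ℕ}

/-- Effect of one throw showing box `b` on a position `c` (the number of counters still in each
box): one counter is removed from box `b` if there is one, and nothing happens otherwise
(subtraction in `ℕ` is truncated). -/
def step (c : Fin k → ℕ) (b : Fin k) : Fin k → ℕ :=
  Function.update c b (c b - 1)

/-- The position after `t` throws, starting from the allocation `n`; `ω s` is the box identified
by the throw number `s + 1`. -/
def position (n : Fin k → ℕ) (ω : ℕ → Fin k) : ℕ → Fin k → ℕ
  | 0 => n
  | t + 1 => step (position n ω t) (ω t)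

/-- The time (number of throws) at which the last counter is removed; `⊤` if this never
happens. -/
noncomputable def removalTime (n : Fin k → ℕ) (ω : ℕ → Fin k) : ℕ∞ :=
  ⨅ (t : ℕ) (_ : position n ω t = 0), (t : ℕ∞)

/-- The law of an infinite sequence of independent throws, each with box probabilities `p`. -/
noncomputable def throws (p : PMF (Fin k)) : Measure (ℕ → Fin k) :=
  Measure.infinitePi (fun _ : ℕ => p.toMeasure)

/-- The expected time to removal of all counters. -/
noncomputable def expectedTime (p : PMF (Fin k)) (n : Fin k → ℕ) : ℝ≥0∞ :=
  ∫⁻ ω, ((removalTime n ω : ℕ∞) : ℝ≥0∞) ∂(throws p)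

/-- Expected payoff to player I, who plays `n`, against player II, who plays `m`, when both
players use the same throws: `1` for a victory, `-1` for a loss and `0` for a draw. -/
noncomputable def commonPayoff (p : PMF (Fin k)) (n m : Fin k → ℕ) : ℝ :=
  (throws p).real {ω | removalTime n ω < removalTime m ω} -
    (throws p).real {ω | removalTime m ω < removalTime n ω}

/-- Expected payoff to player I, who plays `n`, against player II, who plays `m`, when the two
players use independent sequences of throws with the same box probabilities. -/
noncomputable def separatePayoff (p : PMF (Fin k)) (n m : Fin k → ℕ) : ℝ :=
  ((throws p).prod (throws p)).real {z | removalTime n z.1 < removalTime m z.2} -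
    ((throws p).prod (throws p)).real {z | removalTime m z.2 < removalTime n z.1}

/-- The strategies: allocations of `N` counters among `k` boxes. -/
def strategies (k N : ℕ) : Set (Fin k → ℕ) :=
  {n | ∑ i, n i = N}

/-- The allocation obtained from `n` by moving one counter from box `j` to box `i`. -/
def transfer (n : Fin k → ℕ) (j i : Fin k) : Fin k → ℕ :=
  Function.update (Function.update n j (n j - 1)) i (n i + 1)

/-- `n` minimizes the expected time to removal among the allocations of `N` counters. -/
def IsFastest (p : PMF (Fin k)) (N : ℕ) (n : Fin k → ℕ) : Prop :=
  n ∈ strategies k N ∧ ∀ m ∈ strategies k N, expectedTime p n ≤ expectedTime p m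

/-- `n` is a pure optimal strategy of the symmetric zero-sum game in which `V s t` is the payoff
to a player who plays `s` against an opponent who plays `t`: the pair `(n, n)` is a saddle
point. (In `IsSaddlePointOn` the first variable is the one of the minimizing player.) -/
def IsPureOptimal (V : (Fin k → ℕ) → (Fin k → ℕ) → ℝ) (N : ℕ) (n : Fin k → ℕ) : Prop :=
  n ∈ strategies k N ∧
    IsSaddlePointOn (strategies k N) (strategies k N) (fun t s => V s t) n n

/-- The margin of victory of player I, who plays `n`, over player II, who plays `m`, with common
throws: the number of throws that II still needs when I has finished, counted negatively if it
is II who finishes first. (Only a null set of throw sequences gives an infinite removal time when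
all box probabilities are positive.) -/
noncomputable def margin (n m : Fin k → ℕ) (ω : ℕ → Fin k) : ℝ :=
  ((removalTime m ω).toNat : ℝ) - ((removalTime n ω).toNat : ℝ)

/-- The regularized incomplete beta function `I_x(α, β)`. -/
noncomputable def regIncBeta (x α β : ℝ) : ℝ :=
  Real.Gamma (α + β) / (Real.Gamma α * Real.Gamma β) *
    ∫ t in (0 : ℝ)..x, t ^ (α - 1) * (1 - t) ^ (β - 1)

end LiabilityGame

namespace LiabilityGame

variable {k : ℕ}

/-! Both allocations in a transfer come from one: let `u` be `n` with an extra counter in box `i`,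
so that `n = step u i` and the transferred allocation is `step u j`. Taking a counter out commutes
with the throws (`position_step`), so `step u l` is cleared after `t` throws exactly when `u` has
reached `0` or the single counter `e_l` in box `l` (`hit_step_zero_right`). Differences of
removal-time distributions thus become `hit p t u e_j - hit p t u e_i`. With common throws the
transferred allocation wins exactly when the last counter of `u` leaves box `j`, so its payoff is
the sum over `t` of `p_j * hit p t u e_j - p_i * hit p t u e_i`.

The core is `mul_hit_le`: these terms are nonnegative if `p_j ≤ p_i` and `u i ≤ u j`. For equal
counts, interchange `i` and `j` in every throw sequence. A sequence leading to `e_i` shows `i`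
exactly `u i - 1` times and `j` some `u j + s` times, of which `s` are wasted on the dry box; its
mirror image is likelier by the factor `(p_i / p_j) ^ (1 + s)`, at least `p_i / p_j`
(`hit_swap_le`). For unequal counts, condition on the first throw. Strictness comes from a wasted
throw when `p_j < p_i`, or from emptying box `i` first when `u i < u j`.

Pointwise comparison of distributions passes to expectations, as sums of tails, and to separate
payoffs, whose terms increase with `hit p t n 0`. Repeated transfers then give nonincreasing
allocations; for optimal strategies with common throws, symmetry between equally likely boxes is
used instead.

With two boxes, the probability that the last counter leaves box `1` satisfies the recursion of
`successFirst`, whose derivative in the box probability is the beta density. The margin is the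
waiting time for the last counter, geometric with mean `1 / p_l` when it lies in box `l`. -/

instance (p : PMF (Fin k)) : IsProbabilityMeasure (throws p) := by
  unfold throws; infer_instance

/-! ### The law of the throws and conditioning on the first throw -/

/-- The sequence of throws that shows `b` first and continues with `ω`. -/
def prepend (b : Fin k) (ω : ℕ → Fin k) : ℕ → Fin k
  | 0 => b
  | t + 1 => ω t

lemma measurable_prepend :
    Measurable (fun z : Fin k × (ℕ → Fin k) => prepend z.1 z.2) := by
  refine measurable_pi_lambda _ fun t => ?_
  cases t with
  | zero => exact measurable_fst
  | succ t => exact (measurable_pi_apply t).comp measurable_snd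

/-- The source of every first-throw recursion. A product measure is determined by its values on
finite-dimensional boxes, so only those are checked. -/
lemma map_prepend_throws (p : PMF (Fin k)) :
    (p.toMeasure.prod (throws p)).map (fun z => prepend z.1 z.2) = throws p := by
  classical
  refine Measure.eq_infinitePi _ fun s t ht => ?_
  -- Padding with `univ` replaces the finite index set by an initial segment, from which coordinate
  -- `0` splits off.
  set t' : ℕ → Set (Fin k) := fun i => if i ∈ s then t i else Set.univ with ht'
  have ht'm : ∀ i, MeasurableSet (t' i) := fun i => Set.Finite.measurableSet (Set.toFinite _)
  obtain ⟨N, hN⟩ : ∃ N, s ⊆ Finset.range (N + 1) :=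
    ⟨s.sup id, fun i hi => Finset.mem_range.2 (Nat.lt_succ_of_le (Finset.le_sup (f := id) hi))⟩
  have h1 : Set.pi (s : Set ℕ) t = {ω | ∀ i < N + 1, ω i ∈ t' i} := by
    ext ω
    simp only [Set.mem_pi, Set.mem_ofPred_eq, ht', Finset.mem_coe]
    refine ⟨fun h i _ => ?_, fun h i hi => ?_⟩
    · by_cases his : i ∈ s
      · simpa [his] using h i his
      · simp [his]
    · simpa [hi] using h i (Finset.mem_range.1 (hN hi))
  have h2 : (fun z : Fin k × (ℕ → Fin k) => prepend z.1 z.2) ⁻¹' (Set.pi (s : Set ℕ) t)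
      = t' 0 ×ˢ Set.pi (Finset.range N : Set ℕ) (fun i => t' (i + 1)) := by
    rw [h1]
    ext ⟨b, ω⟩
    simp only [Set.mem_preimage, Set.mem_ofPred_eq, Set.mem_prod, Set.mem_pi, Finset.mem_coe,
      Finset.mem_range]
    refine ⟨fun h => ⟨h 0 (by omega), fun i hi => h (i + 1) (by omega)⟩, fun h i hi => ?_⟩
    cases i with
    | zero => exact h.1
    | succ i => exact h.2 i (by omega)
  rw [Measure.map_apply measurable_prepend (.pi s.countable_toSet fun i _ => ht i), h2,
    Measure.prod_prod, throws, Measure.infinitePi_pi _ (fun i _ => ht'm _)]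
  have h3 : ∏ i ∈ s, p.toMeasure (t i) = ∏ i ∈ Finset.range (N + 1), p.toMeasure (t' i) := by
    rw [← Finset.prod_subset hN]
    · exact Finset.prod_congr rfl fun i hi => by simp [ht', hi]
    · intro i _ hi
      simp [ht', hi]
  rw [h3, Finset.prod_range_succ', mul_comm]

lemma throws_real_eq_sum (p : PMF (Fin k)) {S : Set (ℕ → Fin k)} (hS : MeasurableSet S) :
    (throws p).real S = ∑ b, (p b).toReal * (throws p).real {ω | prepend b ω ∈ S} := by
  have h : throws p S = ∑ b, p b * throws p {ω | prepend b ω ∈ S} := by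
    conv_lhs => rw [← map_prepend_throws p]
    rw [Measure.map_apply measurable_prepend hS, Measure.prod_apply (measurable_prepend hS),
      lintegral_fintype]
    refine Finset.sum_congr rfl fun b _ => ?_
    rw [PMF.toMeasure_apply_singleton _ _ (measurableSet_singleton b), mul_comm]
    rfl
  rw [measureReal_def, h, ENNReal.toReal_sum fun b _ =>
    ENNReal.mul_ne_top (p.apply_ne_top b) (measure_ne_top _ _)]
  simp [ENNReal.toReal_mul, measureReal_def]

lemma sum_toReal (p : PMF (Fin k)) : ∑ b, (p b).toReal = 1 := by
  rw [← ENNReal.toReal_sum fun b _ => p.apply_ne_top b, ← tsum_fintype (L := .unconditional _), p.tsum_coe]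
  rfl

/-! ### Positions -/

lemma step_apply (c : Fin k → ℕ) (b l : Fin k) :
    step c b l = if l = b then c l - 1 else c l := by
  unfold step
  rw [Function.update_apply]
  split_ifs with h <;> simp [h]

lemma step_le (c : Fin k → ℕ) (b : Fin k) : step c b ≤ c := fun l => by
  rw [step_apply]
  split_ifs
  · exact Nat.sub_le _ _
  · exact le_rfl

lemma position_prepend (c : Fin k → ℕ) (b : Fin k) (ω : ℕ → Fin k) (t : ℕ) :
    position c (prepend b ω) (t + 1) = position (step c b) ω t := by
  induction t with
  | zero => rfl
  | succ t ih =>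
    change step (position c (prepend b ω) (t + 1)) (ω t) = step (position (step c b) ω t) (ω t)
    rw [ih]

lemma position_antitone (c : Fin k → ℕ) (ω : ℕ → Fin k) : Antitone (position c ω) :=
  antitone_nat_of_succ_le fun _ => step_le _ _

lemma position_apply_eq_of_eq {c d : Fin k → ℕ} {l : Fin k} (h : c l = d l) (ω : ℕ → Fin k)
    (t : ℕ) : position c ω t l = position d ω t l := by
  induction t with
  | zero => exact h
  | succ t ih =>
    change step _ _ l = step _ _ l
    rw [step_apply, step_apply, ih]

lemma position_apply_sub_one {c d : Fin k → ℕ} {l : Fin k} (h : d l = c l - 1) (ω : ℕ → Fin k)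
    (t : ℕ) : position d ω t l = position c ω t l - 1 := by
  induction t with
  | zero => exact h
  | succ t ih =>
    change step _ _ l = step _ _ l - 1
    rw [step_apply, step_apply, ih]
    split_ifs <;> rfl

/-- Throws act on each box by truncated decrements, which commute. A counter missing at the start
may thus be removed at the end instead. -/
lemma position_step (c : Fin k → ℕ) (b : Fin k) (ω : ℕ → Fin k) (t : ℕ) :
    position (step c b) ω t = step (position c ω t) b := by
  funext l
  by_cases h : l = b
  · subst h
    rw [position_apply_sub_one (c := c) (by simp [step_apply])]
    simp [step_apply]
  · rw [position_apply_eq_of_eq (d := c) (by simp [step_apply, h])]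
    simp [step_apply, h]

lemma step_eq_zero_iff (c : Fin k → ℕ) (b : Fin k) :
    step c b = 0 ↔ c = 0 ∨ c = Pi.single b 1 := by
  constructor
  · intro h
    have h0 : ∀ l, (if l = b then c l - 1 else c l) = 0 := fun l => by
      rw [← step_apply, h]; rfl
    by_cases hb : c b = 0
    · left
      funext l
      have := h0 l
      split_ifs at this with hl
      · rw [hl, hb]; rfl
      · exact this
    · right
      funext l
      have := h0 l
      split_ifs at this with hl
      · subst hl; simp; omega
      · simp [hl, this]
  · rintro (rfl | rfl) <;> funext l <;> rw [step_apply]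
    · simp
    · split_ifs with h <;> simp [h]

/-! ### Transition probabilities -/

lemma measurable_position (c : Fin k → ℕ) (t : ℕ) : Measurable fun ω => position c ω t := by
  induction t with
  | zero => exact measurable_const
  | succ t ih =>
    have : Measurable fun z : (Fin k → ℕ) × Fin k => step z.1 z.2 := measurable_of_countable _
    exact this.comp (ih.prodMk (measurable_pi_apply t))

lemma measurableSet_position (c d : Fin k → ℕ) (t : ℕ) :
    MeasurableSet {ω | position c ω t = d} :=
  measurable_position c t (measurableSet_singleton d)

/-- The probability that `t` throws lead from the position `c` to the position `d`. -/
noncomputable def hit (p : PMF (Fin k)) (t : ℕ) (c d : Fin k → ℕ) : ℝ :=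
  (throws p).real {ω | position c ω t = d}

lemma hit_nonneg (p : PMF (Fin k)) (t : ℕ) (c d : Fin k → ℕ) : 0 ≤ hit p t c d :=
  measureReal_nonneg

lemma hit_le_one (p : PMF (Fin k)) (t : ℕ) (c d : Fin k → ℕ) : hit p t c d ≤ 1 :=
  measureReal_le_one

open Classical in
lemma hit_zero (p : PMF (Fin k)) (c d : Fin k → ℕ) : hit p 0 c d = if c = d then 1 else 0 := by
  unfold hit position
  split_ifs with h <;> simp [h]

lemma hit_succ (p : PMF (Fin k)) (t : ℕ) (c d : Fin k → ℕ) :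
    hit p (t + 1) c d = ∑ b, (p b).toReal * hit p t (step c b) d := by
  unfold hit
  rw [throws_real_eq_sum p (measurableSet_position _ _ _)]
  simp only [Set.mem_ofPred_eq, position_prepend]

lemma measurableSet_position_and (c d : Fin k → ℕ) (t : ℕ) (j : Fin k) :
    MeasurableSet {ω | position c ω t = d ∧ ω t = j} :=
  (measurableSet_position c d t).inter
    (measurableSet_eq_fun (measurable_pi_apply t) measurable_const)

/-- The position after `t` throws involves only `ω 0, …, ω (t - 1)`, hence is independent of `ω t`.
-/
lemma throws_real_position_and (p : PMF (Fin k)) (t : ℕ) (c d : Fin k → ℕ) (j : Fin k) :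
    (throws p).real {ω | position c ω t = d ∧ ω t = j} = (p j).toReal * hit p t c d := by
  induction t generalizing c with
  | zero =>
    rw [throws_real_eq_sum p (measurableSet_position_and _ _ _ _), hit_zero]
    rw [Finset.sum_eq_single j]
    · by_cases h : c = d <;> simp [position, prepend, h]
    · intro b _ hb
      simp [prepend, hb]
    · simp
  | succ t ih =>
    rw [throws_real_eq_sum p (measurableSet_position_and _ _ _ _), hit_succ, Finset.mul_sum]
    refine Finset.sum_congr rfl fun b _ => ?_
    have := ih (step c b)
    simp only [Set.mem_ofPred_eq, position_prepend]
    change _ * (throws p).real {ω | position (step c b) ω t = d ∧ ω t = j} = _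
    rw [this]; ring

/-! ### Reaching a position with a single counter -/

lemma step_self_of_eq_zero {c : Fin k → ℕ} {b : Fin k} (h : c b = 0) : step c b = c := by
  funext l
  rw [step_apply]
  split_ifs with hl
  · subst hl; omega
  · rfl

lemma sum_step {c : Fin k → ℕ} {b : Fin k} (h : 0 < c b) :
    ∑ l, step c b l + 1 = ∑ l, c l := by
  rw [← Finset.add_sum_erase _ (step c b) (Finset.mem_univ b),
    ← Finset.add_sum_erase _ c (Finset.mem_univ b)]
  have : ∑ l ∈ Finset.univ.erase b, step c b l = ∑ l ∈ Finset.univ.erase b, c l :=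
    Finset.sum_congr rfl fun l hl => by simp [step_apply, Finset.ne_of_mem_erase hl]
  rw [this, step_apply, if_pos rfl]
  omega

lemma add_le_sum_of_ne (c : Fin k → ℕ) {i j : Fin k} (hij : i ≠ j) : c i + c j ≤ ∑ l, c l := by
  rw [← Finset.sum_pair hij]
  exact Finset.sum_le_sum_of_subset (Finset.subset_univ _)

lemma eq_single_of_sum_le_one {c : Fin k → ℕ} {l : Fin k} (hl : 1 ≤ c l) (h : ∑ i, c i ≤ 1) :
    c = Pi.single l 1 := by
  funext i
  by_cases hi : i = l
  · subst hi
    have := Finset.single_le_sum (fun i _ => Nat.zero_le (c i)) (Finset.mem_univ i)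
    simp; omega
  · have := add_le_sum_of_ne c hi
    simp [hi]; omega

lemma exists_pos_step_pos {c : Fin k → ℕ} {i : Fin k} (hi : 1 ≤ c i) (hc : c ≠ Pi.single i 1) :
    ∃ l, 0 < c l ∧ 1 ≤ step c l i := by
  by_cases h2 : 2 ≤ c i
  · exact ⟨i, by omega, by rw [step_apply, if_pos rfl]; omega⟩
  · obtain ⟨l, hl⟩ : ∃ l, c l ≠ (Pi.single i 1 : Fin k → ℕ) l := Function.ne_iff.1 hc
    have hli : l ≠ i := by
      rintro rfl
      simp at hl
      omega
    rw [Pi.single_eq_of_ne hli] at hl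
    exact ⟨l, by omega, by rw [step_apply, if_neg hli.symm]; exact hi⟩

lemma hit_single_eq_zero (p : PMF (Fin k)) (t : ℕ) {c : Fin k → ℕ} {i : Fin k} (h : c i = 0) :
    hit p t c (Pi.single i 1) = 0 := by
  have : {ω | position c ω t = Pi.single i 1} = ∅ := by
    ext ω
    simp only [Set.mem_ofPred_eq, Set.mem_empty_iff_false, iff_false]
    intro hω
    have := position_antitone c ω (Nat.zero_le t) i
    rw [hω] at this
    change _ ≤ c i at this
    rw [Pi.single_eq_same] at this
    omega
  simp [hit, this]

/-- Remove all counters but one of box `l`, and waste the surplus throws on a box that is empty by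
then; `l'` guarantees that there is one. -/
lemma hit_single_pos {p : PMF (Fin k)} (hp : ∀ i, 0 < (p i).toReal) {l l' : Fin k} (hl : l' ≠ l)
    (t : ℕ) (c : Fin k → ℕ) (hc : 1 ≤ c l) (ht : ∑ i, c i ≤ t + 1) :
    0 < hit p t c (Pi.single l 1) := by
  induction t generalizing c with
  | zero =>
    rw [hit_zero, if_pos (eq_single_of_sum_le_one hc (by omega))]
    exact one_pos
  | succ t ih =>
    have key : ∃ b, 0 < hit p t (step c b) (Pi.single l 1) := by
      by_cases h : c = Pi.single l 1
      · refine ⟨l', ?_⟩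
        rw [step_self_of_eq_zero (by rw [h, Pi.single_eq_of_ne hl])]
        refine ih _ hc ?_
        rw [h, Finset.sum_pi_single']
        simp
      · obtain ⟨b, hb, hb'⟩ := exists_pos_step_pos hc h
        refine ⟨b, ih _ hb' ?_⟩
        have := sum_step hb
        omega
    obtain ⟨b, hb⟩ := key
    rw [hit_succ]
    exact Finset.sum_pos' (fun b _ => mul_nonneg (hp b).le (hit_nonneg _ _ _ _))
      ⟨b, Finset.mem_univ _, mul_pos (hp b) hb⟩

/-! ### Interchanging two boxes -/

lemma step_comp_swap (c : Fin k → ℕ) (i j b : Fin k) :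
    step (c ∘ Equiv.swap i j) (Equiv.swap i j b) = step c b ∘ Equiv.swap i j := by
  funext l
  simp only [step_apply, Function.comp_apply]
  have h : l = Equiv.swap i j b ↔ Equiv.swap i j l = b := by
    rw [← Equiv.symm_apply_eq, Equiv.symm_swap]
  simp only [h]

lemma hit_comp_swap_succ (p : PMF (Fin k)) (t : ℕ) (c d : Fin k → ℕ) (i j : Fin k) :
    hit p (t + 1) (c ∘ Equiv.swap i j) d =
      ∑ b, (p (Equiv.swap i j b)).toReal * hit p t (step c b ∘ Equiv.swap i j) d := by
  rw [hit_succ, ← Equiv.sum_comp (Equiv.swap i j)]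
  simp only [step_comp_swap]

section

variable {p : PMF (Fin k)} {i j : Fin k}

/-- The induction step for the mirror argument, for a throw `b` and its mirror image. The powers
count the throws of `i` and `j` still to be effective, so an effective throw multiplies both sides
alike. -/
lemma weight_le (hp : ∀ i, 0 < (p i).toReal) (hij : i ≠ j) (hle : (p j).toReal ≤ (p i).toReal)
    {c : Fin k → ℕ} (hc : 1 ≤ c i) (b : Fin k) {H H' : ℝ} (hH' : 0 ≤ H')
    (h : (p i).toReal ^ (step c b j + 1) * (p j).toReal ^ (step c b i) * H ≤
      (p j).toReal ^ (step c b j + 1) * (p i).toReal ^ (step c b i) * H') :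
    (p i).toReal ^ (c j + 1) * (p j).toReal ^ (c i) * ((p b).toReal * H) ≤
      (p j).toReal ^ (c j + 1) * (p i).toReal ^ (c i) *
        ((p (Equiv.swap i j b)).toReal * H') := by
  have hx := hp i
  have hy := hp j
  have hb := hp b
  obtain ⟨m, hm⟩ : ∃ m, c i = m + 1 := ⟨c i - 1, by omega⟩
  by_cases hbi : b = i
  · subst hbi
    rw [step_apply, step_apply, if_neg hij.symm, if_pos rfl, hm, Nat.add_sub_cancel] at h
    rw [Equiv.swap_apply_left, hm]
    have := mul_le_mul_of_nonneg_left h (mul_pos hx hy).le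
    linarith [pow_succ (p b).toReal m, pow_succ (p j).toReal m,
      show (p b).toReal * (p j).toReal * ((p b).toReal ^ (c j + 1) * (p j).toReal ^ m * H) =
        (p b).toReal ^ (c j + 1) * (p j).toReal ^ (m + 1) * ((p b).toReal * H) by ring,
      show (p b).toReal * (p j).toReal * ((p j).toReal ^ (c j + 1) * (p b).toReal ^ m * H') =
        (p j).toReal ^ (c j + 1) * (p b).toReal ^ (m + 1) * ((p j).toReal * H') by ring]
  by_cases hbj : b = j
  · subst hbj
    rw [step_apply, step_apply, if_neg hij, if_pos rfl] at h
    rw [Equiv.swap_apply_right]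
    rcases Nat.eq_zero_or_pos (c b) with h0 | h0
    -- A wasted throw of the dry box `j`: its mirror image has the larger probability `p i`. Only
    -- this case needs `hle`.
    · rw [h0] at h ⊢
      have h1 := mul_le_mul_of_nonneg_left h hy.le
      have h2 : (p b).toReal * ((p b).toReal ^ (0 + 1) * (p i).toReal ^ (c i) * H') ≤
          (p i).toReal * ((p b).toReal ^ (0 + 1) * (p i).toReal ^ (c i) * H') :=
        mul_le_mul_of_nonneg_right hle (by positivity)
      simp only [Nat.zero_sub] at h1
      linarith
    · obtain ⟨r, hr⟩ : ∃ r, c b = r + 1 := ⟨c b - 1, by omega⟩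
      rw [hr, Nat.add_sub_cancel] at h
      rw [hr]
      have := mul_le_mul_of_nonneg_left h (mul_pos hx hy).le
      calc _ = (p i).toReal * (p b).toReal *
            ((p i).toReal ^ (r + 1) * (p b).toReal ^ (c i) * H) := by ring
        _ ≤ _ := this
        _ = _ := by ring
  · rw [step_apply, step_apply, if_neg (Ne.symm hbj), if_neg (Ne.symm hbi)] at h
    rw [Equiv.swap_apply_of_ne_of_ne hbi hbj]
    have := mul_le_mul_of_nonneg_left h hb.le
    linarith

lemma weight_lt (hp : ∀ i, 0 < (p i).toReal) (hij : i ≠ j) (hle : (p j).toReal ≤ (p i).toReal)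
    {c : Fin k → ℕ} (hc : 1 ≤ c i) (b : Fin k) {H H' : ℝ} (hH' : 0 ≤ H')
    (h : (p i).toReal ^ (step c b j + 1) * (p j).toReal ^ (step c b i) * H <
      (p j).toReal ^ (step c b j + 1) * (p i).toReal ^ (step c b i) * H') :
    (p i).toReal ^ (c j + 1) * (p j).toReal ^ (c i) * ((p b).toReal * H) <
      (p j).toReal ^ (c j + 1) * (p i).toReal ^ (c i) *
        ((p (Equiv.swap i j b)).toReal * H') := by
  have hx := hp i
  have hy := hp j
  -- `K` turns `h` into an equality, so the weak inequality applies to `K`, and `H < K`.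
  obtain ⟨K, hK, hHK⟩ : ∃ K, H < K ∧
      (p i).toReal ^ (step c b j + 1) * (p j).toReal ^ (step c b i) * K ≤
      (p j).toReal ^ (step c b j + 1) * (p i).toReal ^ (step c b i) * H' := by
    have hA : 0 < (p i).toReal ^ (step c b j + 1) * (p j).toReal ^ (step c b i) := by positivity
    refine ⟨_, (lt_div_iff₀' hA).2 h, ?_⟩
    rw [mul_div_cancel₀ _ hA.ne']
  refine lt_of_lt_of_le ?_ (weight_le hp hij hle hc b hH' hHK)
  have := hp b
  gcongr

/-- Each way of ending with one counter in box `i`, where box `j` has run dry, is at most as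
likely as its mirror image, up to the weights of the counters. -/
lemma hit_swap_le (hp : ∀ i, 0 < (p i).toReal) (hij : i ≠ j)
    (hle : (p j).toReal ≤ (p i).toReal) (t : ℕ) (c : Fin k → ℕ) :
    (p i).toReal ^ (c j + 1) * (p j).toReal ^ (c i) * hit p t c (Pi.single i 1) ≤
      (p j).toReal ^ (c j + 1) * (p i).toReal ^ (c i) *
        hit p t (c ∘ Equiv.swap i j) (Pi.single j 1) := by
  have hx := hp i
  have hy := hp j
  have hnn : ∀ (t : ℕ) (c : Fin k → ℕ), 0 ≤ (p j).toReal ^ (c j + 1) * (p i).toReal ^ (c i) *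
      hit p t (c ∘ Equiv.swap i j) (Pi.single j 1) := fun t c =>
    mul_nonneg (by positivity) (hit_nonneg _ _ _ _)
  induction t generalizing c with
  | zero =>
    by_cases h : c = Pi.single i 1
    · subst h
      have h1 : (Pi.single i 1 : Fin k → ℕ) ∘ Equiv.swap i j = Pi.single j 1 := by
        funext l
        simp [Pi.single_apply, Equiv.swap_apply_eq_iff]
      rw [h1, hit_zero, hit_zero, if_pos rfl, if_pos rfl]
      simp [hij.symm]
      linarith
    · rw [hit_zero, if_neg h, mul_zero]
      exact hnn _ _
  | succ t ih =>
    rcases Nat.eq_zero_or_pos (c i) with h0 | h0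
    · rw [hit_single_eq_zero p _ h0, mul_zero]
      exact hnn _ _
    · rw [hit_succ, hit_comp_swap_succ, Finset.mul_sum, Finset.mul_sum]
      exact Finset.sum_le_sum fun b _ =>
        weight_le hp hij hle h0 b (hit_nonneg _ _ _ _) (ih (step c b))

/-- Strictness appears once only one counter is left, in box `i`, and a throw is wasted on box `j`.
It propagates back along throws that remove the other counters. -/
lemma exists_hit_swap_lt (hp : ∀ i, 0 < (p i).toReal) (hij : i ≠ j)
    (hlt : (p j).toReal < (p i).toReal) (c : Fin k → ℕ) (hc : 1 ≤ c i) :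
    ∃ t, (p i).toReal ^ (c j + 1) * (p j).toReal ^ (c i) * hit p t c (Pi.single i 1) <
      (p j).toReal ^ (c j + 1) * (p i).toReal ^ (c i) *
        hit p t (c ∘ Equiv.swap i j) (Pi.single j 1) := by
  have hx := hp i
  have hy := hp j
  induction hN : ∑ l, c l using Nat.strong_induction_on generalizing c with
  | _ N ih =>
  by_cases h : c = Pi.single i 1
  · refine ⟨1, ?_⟩
    have h1 : (Pi.single i 1 : Fin k → ℕ) ∘ Equiv.swap i j = Pi.single j 1 := by
      funext l
      simp [Pi.single_apply, Equiv.swap_apply_eq_iff]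
    rw [hit_succ, hit_comp_swap_succ, Finset.mul_sum, Finset.mul_sum]
    refine Finset.sum_lt_sum (fun b _ => weight_le hp hij hlt.le hc b (hit_nonneg _ _ _ _)
      (hit_swap_le hp hij hlt.le _ _)) ⟨j, Finset.mem_univ _, ?_⟩
    have h2 : step (Pi.single i 1) j = (Pi.single i 1 : Fin k → ℕ) :=
      step_self_of_eq_zero (Pi.single_eq_of_ne hij.symm _)
    rw [h, h2, h1, hit_zero, hit_zero, if_pos rfl, if_pos rfl, Equiv.swap_apply_right]
    simp [hij.symm]
    have := mul_pos hx hy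
    nlinarith
  · obtain ⟨l, hl, hl'⟩ := exists_pos_step_pos hc h
    have hs := sum_step hl
    obtain ⟨t, ht⟩ := ih _ (by omega) (step c l) hl' rfl
    refine ⟨t + 1, ?_⟩
    rw [hit_succ, hit_comp_swap_succ, Finset.mul_sum, Finset.mul_sum]
    exact Finset.sum_lt_sum (fun b _ => weight_le hp hij hlt.le hc b (hit_nonneg _ _ _ _)
      (hit_swap_le hp hij hlt.le _ _))
      ⟨l, Finset.mem_univ _, weight_lt hp hij hlt.le hc l (hit_nonneg _ _ _ _) ht⟩

/-! ### Which of two boxes provides the last counter -/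

lemma comp_swap_eq_self {α β : Type*} [DecidableEq α] {c : α → β} {i j : α} (h : c i = c j) :
    c ∘ Equiv.swap i j = c := by
  funext l
  rw [Function.comp_apply, Equiv.swap_apply_def]
  split_ifs with h1 h2
  · rw [h1, h]
  · rw [h2, h]
  · rfl

/-- Of two boxes, the likelier of which starts with at most as many counters, it is the other one
that is more likely to provide the last counter. -/
lemma mul_hit_le (hp : ∀ i, 0 < (p i).toReal) (hij : i ≠ j)
    (hle : (p j).toReal ≤ (p i).toReal) (t : ℕ) (c : Fin k → ℕ) (hc : c i ≤ c j) :
    (p i).toReal * hit p t c (Pi.single i 1) ≤ (p j).toReal * hit p t c (Pi.single j 1) := by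
  have hx := hp i
  have hy := hp j
  induction t generalizing c with
  | zero =>
    rw [hit_zero, if_neg, mul_zero]
    · exact mul_nonneg hy.le (hit_nonneg _ _ _ _)
    · rintro rfl
      simp [hij.symm] at hc
  | succ t ih =>
    rcases hc.eq_or_lt with he | hlt
    -- With equal counts the starting position is its own mirror image, and the weights cancel up to
    -- one factor on each side.
    · have h := hit_swap_le hp hij hle (t + 1) c
      rw [comp_swap_eq_self he, ← he] at h
      have hpos : 0 < (p i).toReal ^ (c i) * (p j).toReal ^ (c i) := by positivity
      refine le_of_mul_le_mul_left ?_ hpos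
      calc _ = (p i).toReal ^ (c i + 1) * (p j).toReal ^ (c i) *
            hit p (t + 1) c (Pi.single i 1) := by ring
        _ ≤ _ := h
        _ = _ := by ring
    · rw [hit_succ, hit_succ, Finset.mul_sum, Finset.mul_sum]
      refine Finset.sum_le_sum fun b _ => ?_
      -- A strict inequality of counts can at worst become an equality after one throw.
      have hs : step c b i ≤ step c b j := by
        rw [step_apply, step_apply]
        split_ifs <;> omega
      have := mul_le_mul_of_nonneg_left (ih (step c b) hs) (hp b).le
      linarith

/-- If box `i` has fewer counters, throw `i` until it is empty: then it cannot provide the last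
counter, while box `j` can. For equal counts the gain is that of the mirror argument. -/
lemma exists_mul_hit_lt (hp : ∀ i, 0 < (p i).toReal) (hij : i ≠ j)
    (hle : (p j).toReal ≤ (p i).toReal) (c : Fin k → ℕ)
    (h : c i < c j ∨ 1 ≤ c i ∧ c i = c j ∧ (p j).toReal < (p i).toReal) :
    ∃ t, (p i).toReal * hit p t c (Pi.single i 1) < (p j).toReal * hit p t c (Pi.single j 1) := by
  have hx := hp i
  have hy := hp j
  rcases h with hlt | ⟨h1, he, hlt⟩
  · induction hN : c i generalizing c with
    | zero =>
      refine ⟨∑ l, c l, ?_⟩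
      rw [hit_single_eq_zero p _ hN, mul_zero]
      exact mul_pos hy (hit_single_pos hp hij _ _ (by omega) (by omega))
    | succ m ih =>
      have h1 : step c i i = m := by rw [step_apply, if_pos rfl, hN]; rfl
      have h2 : step c i j = c j := by rw [step_apply, if_neg hij.symm]
      obtain ⟨t, ht⟩ := ih (step c i) (by omega) h1
      refine ⟨t + 1, ?_⟩
      rw [hit_succ, hit_succ, Finset.mul_sum, Finset.mul_sum]
      refine Finset.sum_lt_sum (fun b _ => ?_) ⟨i, Finset.mem_univ _, ?_⟩
      · have hs : step c b i ≤ step c b j := by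
          rw [step_apply, step_apply]
          split_ifs <;> omega
        have := mul_le_mul_of_nonneg_left (mul_hit_le hp hij hle t (step c b) hs) (hp b).le
        linarith
      · have := mul_lt_mul_of_pos_left ht hx
        linarith
  · obtain ⟨t, ht⟩ := exists_hit_swap_lt hp hij hlt c h1
    refine ⟨t, ?_⟩
    rw [comp_swap_eq_self he, ← he] at ht
    have hpos : 0 < (p i).toReal ^ (c i) * (p j).toReal ^ (c i) := by positivity
    refine lt_of_mul_lt_mul_left ?_ hpos.le
    calc _ = (p i).toReal ^ (c i + 1) * (p j).toReal ^ (c i) * hit p t c (Pi.single i 1) := by ring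
      _ < _ := ht
      _ = _ := by ring

lemma hit_le (hp : ∀ i, 0 < (p i).toReal) (hij : i ≠ j)
    (hle : (p j).toReal ≤ (p i).toReal) (t : ℕ) (c : Fin k → ℕ) (hc : c i ≤ c j) :
    hit p t c (Pi.single i 1) ≤ hit p t c (Pi.single j 1) := by
  refine le_of_mul_le_mul_left ((mul_hit_le hp hij hle t c hc).trans ?_) (hp i)
  exact mul_le_mul_of_nonneg_right hle (hit_nonneg _ _ _ _)

lemma hit_lt_of_mul_hit_lt (hp : ∀ i, 0 < (p i).toReal)
    (hle : (p j).toReal ≤ (p i).toReal) {t : ℕ} {c : Fin k → ℕ}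
    (h : (p i).toReal * hit p t c (Pi.single i 1) < (p j).toReal * hit p t c (Pi.single j 1)) :
    hit p t c (Pi.single i 1) < hit p t c (Pi.single j 1) :=
  lt_of_mul_lt_mul_left
    (h.trans_le (mul_le_mul_of_nonneg_right hle (hit_nonneg _ _ _ _))) (hp i).le

lemma hit_eq (hp : ∀ i, 0 < (p i).toReal) (hij : i ≠ j)
    (he : (p j).toReal = (p i).toReal) (t : ℕ) (c : Fin k → ℕ) (hc : c i = c j) :
    hit p t c (Pi.single i 1) = hit p t c (Pi.single j 1) :=
  le_antisymm (hit_le hp hij he.le t c hc.le) (hit_le hp hij.symm he.ge t c hc.ge)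

end

/-! ### Removal times -/

lemma removalTime_le_iff (n : Fin k → ℕ) (ω : ℕ → Fin k) (t : ℕ) :
    removalTime n ω ≤ t ↔ position n ω t = 0 := by
  constructor
  · intro h
    have h' : removalTime n ω < (t + 1 : ℕ) := lt_of_le_of_lt h (by exact_mod_cast t.lt_succ_self)
    obtain ⟨s, hs⟩ := iInf_lt_iff.1 h'
    obtain ⟨hs0, hst⟩ := iInf_lt_iff.1 hs
    have hst' : s ≤ t := Nat.lt_succ_iff.1 (by exact_mod_cast hst)
    have := position_antitone n ω hst'
    rw [hs0] at this
    exact le_antisymm this (fun _ => Nat.zero_le _)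
  · intro h
    exact iInf₂_le t h

lemma lt_removalTime_iff (n : Fin k → ℕ) (ω : ℕ → Fin k) (t : ℕ) :
    (t : ℕ∞) < removalTime n ω ↔ position n ω t ≠ 0 := by
  rw [← not_le, removalTime_le_iff]

lemma removalTime_eq_succ_iff (n : Fin k → ℕ) (ω : ℕ → Fin k) (t : ℕ) :
    removalTime n ω = (t + 1 : ℕ) ↔ position n ω t ≠ 0 ∧ position n ω (t + 1) = 0 := by
  rw [← lt_removalTime_iff, ← removalTime_le_iff]
  constructor
  · intro h
    rw [h]
    exact ⟨by exact_mod_cast t.lt_succ_self, le_rfl⟩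
  · rintro ⟨h1, h2⟩
    refine le_antisymm h2 ?_
    have := Order.add_one_le_of_lt h1
    exact_mod_cast this

lemma measurable_removalTime (n : Fin k → ℕ) : Measurable (removalTime n) := by
  refine ENat.measurable_iff.2 fun t => ?_
  cases t with
  | zero =>
    have : removalTime n ⁻¹' {((0 : ℕ) : ℕ∞)} = {ω | position n ω 0 = 0} := by
      ext ω
      rw [Set.mem_ofPred_eq, ← removalTime_le_iff]
      simp
    rw [this]
    exact measurableSet_position _ _ _
  | succ t =>
    have : removalTime n ⁻¹' {((t + 1 : ℕ) : ℕ∞)} =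
        {ω | position n ω t = 0}ᶜ ∩ {ω | position n ω (t + 1) = 0} := by
      ext ω
      exact removalTime_eq_succ_iff n ω t
    rw [this]
    exact (measurableSet_position _ _ _).compl.inter (measurableSet_position _ _ _)

/-- The probability of having removed all counters of `n` within `t` throws. -/
lemma hit_zero_right (p : PMF (Fin k)) (t : ℕ) (n : Fin k → ℕ) :
    hit p t n 0 = (throws p).real {ω | removalTime n ω ≤ t} := by
  simp only [removalTime_le_iff]
  rfl

lemma real_lt_removalTime (p : PMF (Fin k)) (t : ℕ) (n : Fin k → ℕ) :
    (throws p).real {ω | (t : ℕ∞) < removalTime n ω} = 1 - hit p t n 0 := by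
  rw [hit, ← probReal_compl_eq_one_sub (measurableSet_position _ _ _)]
  congr 1
  ext ω
  exact lt_removalTime_iff n ω t

/-! ### The expected time to removal -/

lemma toENNReal_eq_tsum (x : ℕ∞) :
    (x : ℝ≥0∞) = ∑' t : ℕ, if (t : ℕ∞) < x then 1 else 0 := by
  induction x using ENat.recTopCoe with
  | top => simp
  | coe n =>
    rw [tsum_eq_sum (s := Finset.range n)]
    · rw [Finset.sum_congr rfl (g := fun _ => 1)]
      · simp
      · intro t ht
        simpa using ht
    · intro t ht
      simpa using ht

lemma expectedTime_eq_tsum (p : PMF (Fin k)) (n : Fin k → ℕ) :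
    expectedTime p n = ∑' t : ℕ, ENNReal.ofReal (1 - hit p t n 0) := by
  unfold expectedTime
  simp_rw [toENNReal_eq_tsum (removalTime _ _)]
  have hm : ∀ t : ℕ, MeasurableSet {ω | (t : ℕ∞) < removalTime n ω} := fun t =>
    measurable_removalTime n (MeasurableSet.of_discrete (s := Set.Ioi (t : ℕ∞)))
  rw [lintegral_tsum fun t => (Measurable.ite (hm t) measurable_const
    measurable_const).aemeasurable]
  congr 1
  funext t
  rw [← real_lt_removalTime, measureReal_def, ENNReal.ofReal_toReal (measure_ne_top _ _),
    ← lintegral_indicator_one (hm t)]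
  simp only [Set.indicator_apply, Set.mem_ofPred_eq, Pi.one_apply]

lemma sum_step_div (p : PMF (Fin k)) (c : Fin k → ℕ) {b : Fin k} (hb : 0 < c b) :
    ∑ l, (step c b l : ℝ) / (p l).toReal =
      ∑ l, (c l : ℝ) / (p l).toReal - 1 / (p b).toReal := by
  rw [← Finset.add_sum_erase _ (fun l => (step c b l : ℝ) / (p l).toReal) (Finset.mem_univ b),
    ← Finset.add_sum_erase _ (fun l => (c l : ℝ) / (p l).toReal) (Finset.mem_univ b)]
  have h : ∑ l ∈ Finset.univ.erase b, (step c b l : ℝ) / (p l).toReal =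
      ∑ l ∈ Finset.univ.erase b, (c l : ℝ) / (p l).toReal :=
    Finset.sum_congr rfl fun l hl => by simp [step_apply, Finset.ne_of_mem_erase hl]
  rw [h]
  simp only [step_apply, if_pos]
  rw [Nat.cast_sub hb]
  ring

/-- A drift argument: a throw lowers the potential `∑ c_l / p_l` on average by the number of
nonempty boxes, hence by at least `1` until all counters are gone. The bound does not depend on `t`,
so the tails are summable. -/
lemma sum_range_one_sub_hit_le {p : PMF (Fin k)} (hp : ∀ i, 0 < (p i).toReal) (t : ℕ)
    (n : Fin k → ℕ) :
    ∑ s ∈ Finset.range t, (1 - hit p s n 0) ≤ ∑ l, (n l : ℝ) / (p l).toReal := by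
  have hnn : ∀ c : Fin k → ℕ, 0 ≤ ∑ l, (c l : ℝ) / (p l).toReal := fun c =>
    Finset.sum_nonneg fun l _ => div_nonneg (Nat.cast_nonneg _) (hp l).le
  induction t generalizing n with
  | zero => simpa using hnn n
  | succ t ih =>
    by_cases hn : n = 0
    · have h : ∀ s, hit p s n 0 = 1 := fun s => by
        have : {ω : ℕ → Fin k | position n ω s = 0} = Set.univ := by
          ext ω
          simp only [Set.mem_ofPred_eq, Set.mem_univ, iff_true]
          have := position_antitone n ω (Nat.zero_le s)
          exact le_antisymm (this.trans_eq hn) (fun _ => Nat.zero_le _)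
        simp [hit, this]
      simpa [h] using hnn n
    · obtain ⟨a, ha⟩ : ∃ a, n a ≠ 0 := Function.ne_iff.1 hn
      have h1 : ∀ s, 1 - hit p (s + 1) n 0 = ∑ b, (p b).toReal * (1 - hit p s (step n b) 0) := by
        intro s
        rw [hit_succ]
        simp only [mul_sub, mul_one, Finset.sum_sub_distrib, sum_toReal]
      -- One nonempty box `a` suffices: its share of the drift is `p a * (1 / p a) = 1`, and the
      -- other shares are discarded.
      have h2 : ∀ b, (p b).toReal * ∑ s ∈ Finset.range t, (1 - hit p s (step n b) 0) ≤
          (p b).toReal * (∑ l, (n l : ℝ) / (p l).toReal) - if b = a then 1 else 0 := by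
        intro b
        have hb := hp b
        refine (mul_le_mul_of_nonneg_left (ih (step n b)) hb.le).trans ?_
        rcases Nat.eq_zero_or_pos (n b) with h0 | h0
        · rw [step_self_of_eq_zero h0, if_neg]
          · linarith
          · rintro rfl
            exact ha h0
        · rw [sum_step_div p n h0, mul_sub, mul_one_div_cancel hb.ne']
          split_ifs <;> linarith
      rw [Finset.sum_range_succ', hit_zero, if_neg hn]
      simp only [h1]
      rw [Finset.sum_comm]
      simp only [← Finset.mul_sum]
      have h3 := Finset.sum_le_sum fun b (_ : b ∈ Finset.univ) => h2 b
      rw [Finset.sum_sub_distrib, ← Finset.sum_mul, sum_toReal] at h3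
      simp only [Finset.sum_ite_eq', Finset.mem_univ, if_true] at h3
      linarith

lemma summable_one_sub_hit {p : PMF (Fin k)} (hp : ∀ i, 0 < (p i).toReal) (n : Fin k → ℕ) :
    Summable fun t => 1 - hit p t n 0 :=
  summable_of_sum_range_le (fun _ => sub_nonneg.2 (hit_le_one _ _ _ _))
    fun t => sum_range_one_sub_hit_le hp t n

lemma expectedTime_eq_ofReal {p : PMF (Fin k)} (hp : ∀ i, 0 < (p i).toReal) (n : Fin k → ℕ) :
    expectedTime p n = ENNReal.ofReal (∑' t : ℕ, (1 - hit p t n 0)) := by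
  rw [expectedTime_eq_tsum, ENNReal.ofReal_tsum_of_nonneg
    (fun _ => sub_nonneg.2 (hit_le_one _ _ _ _)) (summable_one_sub_hit hp n)]

lemma expectedTime_lt_top {p : PMF (Fin k)} (hp : ∀ i, 0 < (p i).toReal) (n : Fin k → ℕ) :
    expectedTime p n < ⊤ := by
  rw [expectedTime_eq_ofReal hp]
  exact ENNReal.ofReal_lt_top

lemma expectedTime_le {p : PMF (Fin k)} {n m : Fin k → ℕ}
    (h : ∀ t, hit p t m 0 ≤ hit p t n 0) : expectedTime p n ≤ expectedTime p m := by
  rw [expectedTime_eq_tsum, expectedTime_eq_tsum]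
  exact ENNReal.tsum_le_tsum fun t => ENNReal.ofReal_le_ofReal (by linarith [h t])

lemma expectedTime_lt {p : PMF (Fin k)} (hp : ∀ i, 0 < (p i).toReal) {n m : Fin k → ℕ}
    (h : ∀ t, hit p t m 0 ≤ hit p t n 0) (h' : ∃ t, hit p t m 0 < hit p t n 0) :
    expectedTime p n < expectedTime p m := by
  obtain ⟨t, ht⟩ := h'
  have hlt : ∑' t : ℕ, (1 - hit p t n 0) < ∑' t : ℕ, (1 - hit p t m 0) :=
    Summable.tsum_lt_tsum (i := t) (fun t => by linarith [h t]) (by linarith)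
      (summable_one_sub_hit hp n) (summable_one_sub_hit hp m)
  rw [expectedTime_eq_ofReal hp, expectedTime_eq_ofReal hp]
  refine (ENNReal.ofReal_lt_ofReal_iff (lt_of_le_of_lt ?_ hlt)).2 hlt
  exact tsum_nonneg fun _ => sub_nonneg.2 (hit_le_one _ _ _ _)

lemma ae_removalTime_ne_top {p : PMF (Fin k)} (hp : ∀ i, 0 < (p i).toReal) (n : Fin k → ℕ) :
    ∀ᵐ ω ∂(throws p), removalTime n ω ≠ ⊤ := by
  have hm : Measurable fun ω => ((removalTime n ω : ℕ∞) : ℝ≥0∞) :=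
    Measurable.of_discrete.comp (measurable_removalTime n)
  filter_upwards [ae_lt_top hm (expectedTime_lt_top hp n).ne] with ω hω
  exact ENat.toENNReal_lt_top.1 hω |>.ne

/-! ### The last counter -/

/-- By `position_step`, the missing counter can be taken from the final position of `u`, which must
then be `0` or one counter in box `l`. -/
lemma hit_step_zero_right (p : PMF (Fin k)) (u : Fin k → ℕ) (l : Fin k) (t : ℕ) :
    hit p t (step u l) 0 = hit p t u 0 + hit p t u (Pi.single l 1) := by
  unfold hit
  rw [← measureReal_union _ (measurableSet_position _ _ _)]
  · congr 1
    ext ω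
    simp only [Set.mem_ofPred_eq, Set.mem_union, position_step, step_eq_zero_iff]
  · rw [Set.disjoint_left]
    intro ω h1 h2
    simp only [Set.mem_ofPred_eq] at h1 h2
    rw [h1] at h2
    have := congrFun h2 l
    simp at this

lemma step_single_self (l : Fin k) : step (Pi.single l 1) l = 0 :=
  (step_eq_zero_iff _ _).2 (Or.inr rfl)

lemma step_single_of_ne {l l' : Fin k} (h : l' ≠ l) :
    step (Pi.single l 1) l' = (Pi.single l 1 : Fin k → ℕ) :=
  step_self_of_eq_zero (Pi.single_eq_of_ne h _)

lemma exists_last_throw {u : Fin k → ℕ} (hu : u ≠ 0) {ω : ℕ → Fin k}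
    (h : removalTime u ω ≠ ⊤) : ∃ t, position u ω t = Pi.single (ω t) 1 := by
  obtain ⟨r, hr⟩ := ENat.ne_top_iff_exists.1 h
  cases r with
  | zero =>
    exact absurd ((removalTime_le_iff u ω 0).1 hr.ge) hu
  | succ t =>
    obtain ⟨h1, h2⟩ := (removalTime_eq_succ_iff u ω t).1 hr.symm
    exact ⟨t, ((step_eq_zero_iff _ _).1 h2).resolve_left h1⟩

lemma removalTime_step_last {u : Fin k → ℕ} {ω : ℕ → Fin k} {t : ℕ}
    (h : position u ω t = Pi.single (ω t) 1) : removalTime (step u (ω t)) ω ≤ t := by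
  rw [removalTime_le_iff, position_step, h, step_single_self]

lemma removalTime_of_last {u : Fin k → ℕ} {ω : ℕ → Fin k} {t : ℕ}
    (h : position u ω t = Pi.single (ω t) 1) : removalTime u ω = (t + 1 : ℕ) := by
  rw [removalTime_eq_succ_iff, h]
  refine ⟨fun h0 => ?_, ?_⟩
  · have := congrFun h0 (ω t)
    simp at this
  · change step (position u ω t) (ω t) = 0
    rw [h, step_single_self]

lemma removalTime_step_of_last {u : Fin k → ℕ} {ω : ℕ → Fin k} {t : ℕ}
    (h : position u ω t = Pi.single (ω t) 1) {l : Fin k} (hl : l ≠ ω t) :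
    removalTime (step u l) ω = (t + 1 : ℕ) := by
  rw [removalTime_eq_succ_iff, position_step, position_step, h, step_single_of_ne hl]
  refine ⟨fun h0 => ?_, ?_⟩
  · have := congrFun h0 (ω t)
    simp at this
  · change step (step (position u ω t) (ω t)) l = 0
    rw [h, step_single_self, step_eq_zero_iff]
    exact Or.inl rfl

/-- If the last counter of `u` leaves box `l`, then `step u l` is already empty before that throw,
whereas every other `step u l'` is finished by that very throw. -/
lemma removalTime_step_lt_iff {u : Fin k → ℕ} (hu : u ≠ 0) {ω : ℕ → Fin k}
    (h : removalTime u ω ≠ ⊤) {i j : Fin k} (hij : i ≠ j) :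
    removalTime (step u j) ω < removalTime (step u i) ω ↔
      ∃ t, position u ω t = Pi.single j 1 ∧ ω t = j := by
  constructor
  · intro hlt
    obtain ⟨t, ht⟩ := exists_last_throw hu h
    by_cases hj : ω t = j
    · exact ⟨t, by rw [ht, hj], hj⟩
    · exfalso
      rw [removalTime_step_of_last ht (Ne.symm hj)] at hlt
      by_cases hi : ω t = i
      · have := removalTime_step_last ht
        rw [hi] at this
        exact absurd (hlt.trans_le this) (by simp)
      · rw [removalTime_step_of_last ht (Ne.symm hi)] at hlt
        exact lt_irrefl _ hlt
  · rintro ⟨t, ht, rfl⟩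
    rw [removalTime_step_of_last ht hij]
    exact (removalTime_step_last ht).trans_lt (by exact_mod_cast t.lt_succ_self)

lemma hasSum_real_iUnion {Ω : Type*} [MeasurableSpace Ω] (μ : Measure Ω) [IsFiniteMeasure μ]
    {s : ℕ → Set Ω} (hd : Pairwise (Function.onFun Disjoint s)) (hs : ∀ t, MeasurableSet (s t)) :
    HasSum (fun t => μ.real (s t)) (μ.real (⋃ t, s t)) := by
  have h := measure_iUnion (μ := μ) hd hs
  rw [measureReal_def, h, ENNReal.tsum_toReal_eq fun _ => measure_ne_top _ _]
  exact ENNReal.hasSum_toReal (by rw [← h]; exact measure_ne_top _ _)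

/-- The allocation obtained from `u` by taking a counter from box `j` beats with common throws
the one obtained by taking a counter from box `i` exactly when the last counter of `u` is removed
from box `j`. -/
lemma hasSum_removalTime_step_lt {p : PMF (Fin k)} (hp : ∀ i, 0 < (p i).toReal)
    {u : Fin k → ℕ} (hu : u ≠ 0) {i j : Fin k} (hij : i ≠ j) :
    HasSum (fun t => (p j).toReal * hit p t u (Pi.single j 1))
      ((throws p).real {ω | removalTime (step u j) ω < removalTime (step u i) ω}) := by
  have h1 : (throws p).real {ω | removalTime (step u j) ω < removalTime (step u i) ω} =
      (throws p).real (⋃ t, {ω | position u ω t = Pi.single j 1 ∧ ω t = j}) := by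
    refine measureReal_congr (Filter.eventuallyEq_set.2 ?_)
    filter_upwards [ae_removalTime_ne_top hp u] with ω hω
    rw [removalTime_step_lt_iff hu hω hij, Set.mem_iUnion]
    rfl
  rw [h1]
  simp only [← throws_real_position_and]
  refine hasSum_real_iUnion _ (fun s t hst => ?_) fun t => measurableSet_position_and _ _ _ _
  refine Set.disjoint_left.2 ?_
  rintro ω ⟨h2, h3⟩ ⟨h4, h5⟩
  rw [← h3] at h2
  rw [← h5] at h4
  have := (removalTime_of_last h2).symm.trans (removalTime_of_last h4)
  exact hst (by simpa using this)

lemma hasSum_commonPayoff_step {p : PMF (Fin k)} (hp : ∀ i, 0 < (p i).toReal)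
    {u : Fin k → ℕ} (hu : u ≠ 0) {i j : Fin k} (hij : i ≠ j) :
    HasSum (fun t => (p j).toReal * hit p t u (Pi.single j 1) -
      (p i).toReal * hit p t u (Pi.single i 1)) (commonPayoff p (step u j) (step u i)) :=
  (hasSum_removalTime_step_lt hp hu hij).sub (hasSum_removalTime_step_lt hp hu hij.symm)

/-! ### Separate throws -/

/-- Surplus throws can be wasted, given a second box. This provides the atoms of the opponent's time
needed for strictness. -/
lemma real_removalTime_eq_pos {p : PMF (Fin k)} (hp : ∀ i, 0 < (p i).toReal) {i j : Fin k}
    (hij : i ≠ j) {m : Fin k → ℕ} (hm : m ≠ 0) {t : ℕ} (ht : ∑ l, m l ≤ t) :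
    0 < (throws p).real {ω | removalTime m ω = t} := by
  obtain ⟨l, hl⟩ : ∃ l, m l ≠ 0 := Function.ne_iff.1 hm
  obtain ⟨l', hl'⟩ : ∃ l', l' ≠ l := by
    by_cases h : i = l
    · exact ⟨j, fun h' => hij (h.trans h'.symm)⟩
    · exact ⟨i, h⟩
  have hle := Finset.single_le_sum (fun i _ => Nat.zero_le (m i)) (Finset.mem_univ l)
  obtain ⟨s, rfl⟩ : ∃ s, t = s + 1 := ⟨t - 1, by omega⟩
  refine (mul_pos (hp l) (hit_single_pos hp hl' s m (by omega) ht)).trans_le ?_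
  rw [← throws_real_position_and]
  refine measureReal_mono ?_
  rintro ω ⟨h1, rfl⟩
  exact removalTime_of_last h1

lemma sum_le_of_hit_pos {p : PMF (Fin k)} {t : ℕ} {n : Fin k → ℕ} (h : 0 < hit p t n 0) :
    ∑ l, n l ≤ t := by
  have hne : {ω | position n ω t = 0}.Nonempty := by
    by_contra h0
    rw [Set.not_nonempty_iff_eq_empty] at h0
    simp [hit, h0] at h
  obtain ⟨ω, hω⟩ := hne
  have key : ∀ s, ∑ l, n l ≤ ∑ l, position n ω s l + s := by
    intro s
    induction s with
    | zero => exact le_rfl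
    | succ s ih =>
      change _ ≤ ∑ l, step (position n ω s) (ω s) l + (s + 1)
      rcases Nat.eq_zero_or_pos (position n ω s (ω s)) with h0 | h0
      · rw [step_self_of_eq_zero h0]
        omega
      · have := sum_step h0
        omega
  have := key t
  rw [Set.mem_ofPred_eq] at hω
  rw [hω] at this
  simpa using this

/-- The event is split by the value `t + 1` of the opponent's time; the value `0` cannot be beaten,
and the value `⊤` is negligible. -/
lemma hasSum_separate_lt {p : PMF (Fin k)} (hp : ∀ i, 0 < (p i).toReal) (n m : Fin k → ℕ) :
    HasSum (fun t : ℕ => hit p t n 0 * (throws p).real {ω | removalTime m ω = (t + 1 : ℕ)})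
      (((throws p).prod (throws p)).real {z | removalTime n z.1 < removalTime m z.2}) := by
  have hm : ∀ x : ℕ∞, MeasurableSet {ω | removalTime m ω = x} := fun x =>
    measurable_removalTime m (measurableSet_singleton x)
  have hn : ∀ t : ℕ, MeasurableSet {ω | removalTime n ω ≤ t} := fun t =>
    measurable_removalTime n (MeasurableSet.of_discrete (s := Set.Iic (t : ℕ∞)))
  have h1 : ((throws p).prod (throws p)).real {z | removalTime n z.1 < removalTime m z.2} =
      ((throws p).prod (throws p)).real (⋃ t : ℕ, {ω | removalTime n ω ≤ t} ×ˢ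
        {ω | removalTime m ω = (t + 1 : ℕ)}) := by
    refine measureReal_congr (Filter.eventuallyEq_set.2 ?_)
    filter_upwards [Measure.quasiMeasurePreserving_snd.ae (ae_removalTime_ne_top hp m)] with z hz
    simp only [Set.mem_ofPred_eq, Set.mem_iUnion, Set.mem_prod]
    obtain ⟨r, hr⟩ := ENat.ne_top_iff_exists.1 hz
    constructor
    · intro h
      rw [← hr] at h ⊢
      cases r with
      | zero => simp at h
      | succ r =>
        refine ⟨r, ?_, rfl⟩
        exact Order.le_of_lt_add_one (by exact_mod_cast h)
    · rintro ⟨t, h2, h3⟩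
      rw [h3]
      exact h2.trans_lt (by exact_mod_cast t.lt_succ_self)
  rw [h1]
  simp only [hit_zero_right, ← measureReal_prod_prod]
  refine hasSum_real_iUnion _ (fun s t hst => ?_) fun t => (hn t).prod (hm _)
  refine Set.disjoint_left.2 ?_
  rintro z ⟨_, h3⟩ ⟨_, h5⟩
  exact hst (by simpa using h3.symm.trans h5)

lemma hasSum_separate_gt (p : PMF (Fin k)) (n m : Fin k → ℕ) :
    HasSum (fun t : ℕ => (1 - hit p t n 0) * (throws p).real {ω | removalTime m ω = t})
      (((throws p).prod (throws p)).real {z | removalTime m z.2 < removalTime n z.1}) := by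
  have hm : ∀ x : ℕ∞, MeasurableSet {ω | removalTime m ω = x} := fun x =>
    measurable_removalTime m (measurableSet_singleton x)
  have hn : ∀ t : ℕ, MeasurableSet {ω | (t : ℕ∞) < removalTime n ω} := fun t =>
    measurable_removalTime n (MeasurableSet.of_discrete (s := Set.Ioi (t : ℕ∞)))
  have h1 : {z : (ℕ → Fin k) × (ℕ → Fin k) | removalTime m z.2 < removalTime n z.1} =
      ⋃ t : ℕ, {ω | (t : ℕ∞) < removalTime n ω} ×ˢ {ω | removalTime m ω = t} := by
    ext z
    simp only [Set.mem_ofPred_eq, Set.mem_iUnion, Set.mem_prod]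
    constructor
    · intro h
      obtain ⟨r, hr⟩ := ENat.ne_top_iff_exists.1 (ne_top_of_lt h)
      exact ⟨r, by rwa [hr], hr.symm⟩
    · rintro ⟨t, h2, h3⟩
      rwa [h3]
  rw [h1]
  simp only [← real_lt_removalTime, ← measureReal_prod_prod]
  refine hasSum_real_iUnion _ (fun s t hst => ?_) fun t => (hn t).prod (hm _)
  refine Set.disjoint_left.2 ?_
  rintro z ⟨_, h3⟩ ⟨_, h5⟩
  exact hst (by simpa using h3.symm.trans h5)

lemma hasSum_separatePayoff {p : PMF (Fin k)} (hp : ∀ i, 0 < (p i).toReal) (n m : Fin k → ℕ) :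
    HasSum (fun t : ℕ => hit p t n 0 * (throws p).real {ω | removalTime m ω = (t + 1 : ℕ)} -
        (1 - hit p t n 0) * (throws p).real {ω | removalTime m ω = t})
      (separatePayoff p n m) :=
  (hasSum_separate_lt hp n m).sub (hasSum_separate_gt p n m)

/-- The coefficient of `hit p t n 0` is the probability that the opponent's time is `t` or `t + 1`.
-/
lemma separatePayoff_term_le (p : PMF (Fin k)) {n n' : Fin k → ℕ} (m : Fin k → ℕ) {t : ℕ}
    (h : hit p t n 0 ≤ hit p t n' 0) :
    hit p t n 0 * (throws p).real {ω | removalTime m ω = (t + 1 : ℕ)} -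
        (1 - hit p t n 0) * (throws p).real {ω | removalTime m ω = t} ≤
      hit p t n' 0 * (throws p).real {ω | removalTime m ω = (t + 1 : ℕ)} -
        (1 - hit p t n' 0) * (throws p).real {ω | removalTime m ω = t} := by
  gcongr

lemma separatePayoff_le {p : PMF (Fin k)} (hp : ∀ i, 0 < (p i).toReal) {n n' : Fin k → ℕ}
    (h : ∀ t, hit p t n 0 ≤ hit p t n' 0) (m : Fin k → ℕ) :
    separatePayoff p n m ≤ separatePayoff p n' m :=
  hasSum_le (fun t => separatePayoff_term_le p m (h t))
    (hasSum_separatePayoff hp n m) (hasSum_separatePayoff hp n' m)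

lemma separatePayoff_lt {p : PMF (Fin k)} (hp : ∀ i, 0 < (p i).toReal) {i j : Fin k}
    (hij : i ≠ j) {n n' m : Fin k → ℕ} (hm : m ≠ 0) (hsum : ∑ l, m l = ∑ l, n' l)
    (h : ∀ t, hit p t n 0 ≤ hit p t n' 0) (h' : ∃ t, hit p t n 0 < hit p t n' 0) :
    separatePayoff p n m < separatePayoff p n' m := by
  obtain ⟨t, ht⟩ := h'
  refine hasSum_lt (i := t) (fun t => separatePayoff_term_le p m (h t)) ?_
    (hasSum_separatePayoff hp n m) (hasSum_separatePayoff hp n' m)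
  -- At a time of strict gain `n'` may be finished, so `t` is at least the number of counters, and
  -- the opponent's time equals `t` with positive probability.
  have h1 : ∑ l, m l ≤ t :=
    hsum.trans_le (sum_le_of_hit_pos ((hit_nonneg _ _ _ _).trans_lt ht))
  have h2 := real_removalTime_eq_pos hp hij hm h1
  have h3 : 0 ≤ (throws p).real {ω | removalTime m ω = (t + 1 : ℕ)} := measureReal_nonneg
  nlinarith [mul_pos (sub_pos.2 ht) h2, mul_nonneg (sub_pos.2 ht).le h3]

lemma commonPayoff_antisymm (p : PMF (Fin k)) (n m : Fin k → ℕ) :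
    commonPayoff p n m = -commonPayoff p m n := by
  unfold commonPayoff
  ring

lemma separatePayoff_antisymm (p : PMF (Fin k)) (n m : Fin k → ℕ) :
    separatePayoff p n m = -separatePayoff p m n := by
  have key : ∀ n m : Fin k → ℕ,
      ((throws p).prod (throws p)).real {z | removalTime n z.1 < removalTime m z.2} =
      ((throws p).prod (throws p)).real {z | removalTime n z.2 < removalTime m z.1} := by
    intro n m
    have hs : MeasurableSet {z : (ℕ → Fin k) × (ℕ → Fin k) |
        removalTime n z.1 < removalTime m z.2} :=
      (((measurable_removalTime n).comp measurable_fst).prodMk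
        ((measurable_removalTime m).comp measurable_snd))
        (MeasurableSet.of_discrete (s := {x : ℕ∞ × ℕ∞ | x.1 < x.2}))
    conv_lhs => rw [← Measure.prod_swap]
    rw [measureReal_def, Measure.map_apply measurable_swap hs]
    rfl
  unfold separatePayoff
  rw [key n m, key m n]
  ring

/-! ### A single transfer -/

/-- The common ancestor `u` is `n` with one more counter in box `i`; it turns a transfer into a
choice of the box to take a counter from. -/
lemma exists_step_eq_transfer (n : Fin k → ℕ) {i j : Fin k} (hij : i ≠ j) :
    ∃ u : Fin k → ℕ, step u i = n ∧ step u j = transfer n j i ∧ u i = n i + 1 ∧ u j = n j := by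
  refine ⟨Function.update n i (n i + 1), ?_, ?_, by simp, by simp [hij.symm]⟩
  · funext l
    rw [step_apply]
    split_ifs with h <;> simp [h]
  · funext l
    rw [step_apply, transfer]
    by_cases hi : l = i
    · subst hi; simp [hij]
    · by_cases hj : l = j
      · subst hj; simp [hij.symm]
      · simp [hi, hj]

lemma sum_transfer (n : Fin k → ℕ) {i j : Fin k} (hij : i ≠ j) (hj : 0 < n j) :
    ∑ l, transfer n j i l = ∑ l, n l := by
  obtain ⟨u, hui, huj, h1, h2⟩ := exists_step_eq_transfer n hij
  have h3 := sum_step (c := u) (b := i) (by omega)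
  have h4 := sum_step (c := u) (b := j) (by omega)
  rw [hui] at h3
  rw [huj] at h4
  omega

lemma sum_mul_step (w : Fin k → ℕ) {c : Fin k → ℕ} {b : Fin k} (h : 0 < c b) :
    ∑ l, w l * step c b l + w b = ∑ l, w l * c l := by
  rw [← Finset.add_sum_erase _ (fun l => w l * step c b l) (Finset.mem_univ b),
    ← Finset.add_sum_erase _ (fun l => w l * c l) (Finset.mem_univ b)]
  have h1 : ∑ l ∈ Finset.univ.erase b, w l * step c b l = ∑ l ∈ Finset.univ.erase b, w l * c l :=
    Finset.sum_congr rfl fun l hl => by simp [step_apply, Finset.ne_of_mem_erase hl]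
  obtain ⟨r, hr⟩ : ∃ r, c b = r + 1 := ⟨c b - 1, by omega⟩
  rw [h1, step_apply, if_pos rfl, hr, Nat.add_sub_cancel]
  ring

/-- The decreasing measure that makes repeated transfers terminate. -/
lemma sum_mul_transfer_lt (n : Fin k → ℕ) {i j : Fin k} (hij : i < j) (hj : 0 < n j) :
    ∑ l : Fin k, (l : ℕ) * transfer n j i l < ∑ l : Fin k, (l : ℕ) * n l := by
  obtain ⟨u, hui, huj, h1, h2⟩ := exists_step_eq_transfer n hij.ne
  have h3 := sum_mul_step (fun l : Fin k => (l : ℕ)) (c := u) (b := i) (by omega)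
  have h4 := sum_mul_step (fun l : Fin k => (l : ℕ)) (c := u) (b := j) (by omega)
  rw [hui] at h3
  rw [huj] at h4
  have : (i : ℕ) < j := hij
  omega

/-- A property of allocations that persists under some transfers towards the first boxes as long
as the allocation is not nonincreasing holds for a nonincreasing allocation. -/
lemma exists_antitone_of_transfer {P : (Fin k → ℕ) → Prop}
    (h : ∀ n i j, P n → i < j → n i < n j → P (transfer n j i)) (n : Fin k → ℕ) (hn : P n) :
    ∃ n', Antitone n' ∧ P n' := by
  induction hN : ∑ l : Fin k, (l : ℕ) * n l using Nat.strong_induction_on generalizing n with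
  | _ N ih =>
  by_cases ha : Antitone n
  · exact ⟨n, ha, hn⟩
  · rw [antitone_iff_forall_lt] at ha
    push Not at ha
    obtain ⟨i, j, hij, hlt⟩ := ha
    have := sum_mul_transfer_lt n hij (by omega)
    exact ih _ (by omega) _ (h n i j hn hij hlt) rfl

section

variable {p : PMF (Fin k)} {i j : Fin k} {n : Fin k → ℕ}

lemma hit_transfer_le (hp : ∀ i, 0 < (p i).toReal) (hij : i ≠ j)
    (hle : (p j).toReal ≤ (p i).toReal) (hn : n i < n j) (t : ℕ) :
    hit p t n 0 ≤ hit p t (transfer n j i) 0 := by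
  obtain ⟨u, hui, huj, h1, h2⟩ := exists_step_eq_transfer n hij
  rw [← huj]
  conv_lhs => rw [← hui]
  rw [hit_step_zero_right, hit_step_zero_right]
  linarith [hit_le hp hij hle t u (by omega)]

lemma exists_hit_transfer_lt (hp : ∀ i, 0 < (p i).toReal) (hij : i ≠ j)
    (hle : (p j).toReal ≤ (p i).toReal) (hn : n i < n j)
    (h : (p j).toReal < (p i).toReal ∨ n i + 1 < n j) :
    ∃ t, hit p t n 0 < hit p t (transfer n j i) 0 := by
  obtain ⟨u, hui, huj, h1, h2⟩ := exists_step_eq_transfer n hij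
  obtain ⟨t, ht⟩ := exists_mul_hit_lt hp hij hle u (by
    rw [h1, h2]
    by_cases h' : n i + 1 < n j
    · exact Or.inl h'
    · exact Or.inr ⟨by omega, by omega, h.resolve_right h'⟩)
  refine ⟨t, ?_⟩
  rw [← huj]
  conv_lhs => rw [← hui]
  rw [hit_step_zero_right, hit_step_zero_right]
  linarith [hit_lt_of_mul_hit_lt hp hle ht]

lemma hit_transfer_eq (hp : ∀ i, 0 < (p i).toReal) (hij : i ≠ j)
    (he : (p j).toReal = (p i).toReal) (hn : n i + 1 = n j) (t : ℕ) :
    hit p t n 0 = hit p t (transfer n j i) 0 := by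
  obtain ⟨u, hui, huj, h1, h2⟩ := exists_step_eq_transfer n hij
  rw [← huj]
  conv_lhs => rw [← hui]
  rw [hit_step_zero_right, hit_step_zero_right, hit_eq hp hij he t u (by omega)]

lemma commonPayoff_transfer (hp : ∀ i, 0 < (p i).toReal) (hij : i ≠ j)
    (hle : (p j).toReal ≤ (p i).toReal) (hn : n i < n j) :
    0 ≤ commonPayoff p (transfer n j i) n ∧
      (0 < commonPayoff p (transfer n j i) n ↔
        (p j).toReal < (p i).toReal ∨ n i + 1 < n j) := by
  obtain ⟨u, hui, huj, h1, h2⟩ := exists_step_eq_transfer n hij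
  have hu : u ≠ 0 := fun h => by
    rw [h] at h1
    simp at h1
  have hs := hasSum_commonPayoff_step hp hu hij
  rw [hui, huj] at hs
  have hnn : ∀ t, 0 ≤ (p j).toReal * hit p t u (Pi.single j 1) -
      (p i).toReal * hit p t u (Pi.single i 1) := fun t =>
    sub_nonneg.2 (mul_hit_le hp hij hle t u (by omega))
  refine ⟨hs.nonneg hnn, fun h => ?_, fun h => ?_⟩
  · by_contra hC
    push Not at hC
    have h0 : ∀ t, (p j).toReal * hit p t u (Pi.single j 1) -
        (p i).toReal * hit p t u (Pi.single i 1) = 0 := fun t => by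
      have he := le_antisymm hle hC.1
      rw [hit_eq hp hij he t u (by omega), he, sub_self]
    simp only [h0] at hs
    exact h.ne' (hs.unique hasSum_zero)
  · obtain ⟨t, ht⟩ := exists_mul_hit_lt hp hij hle u (by
      rw [h1, h2]
      by_cases h' : n i + 1 < n j
      · exact Or.inl h'
      · exact Or.inr ⟨by omega, by omega, h.resolve_right h'⟩)
    exact hasSum_lt (i := t) hnn (sub_pos.2 ht) hasSum_zero hs

lemma expectedTime_transfer (hp : ∀ i, 0 < (p i).toReal) (hij : i ≠ j)
    (hle : (p j).toReal ≤ (p i).toReal) (hn : n i < n j) :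
    expectedTime p (transfer n j i) ≤ expectedTime p n ∧
      (expectedTime p (transfer n j i) < expectedTime p n ↔
        (p j).toReal < (p i).toReal ∨ n i + 1 < n j) := by
  refine ⟨expectedTime_le (hit_transfer_le hp hij hle hn), fun h => ?_, fun h => ?_⟩
  · by_contra hC
    push Not at hC
    exact absurd (expectedTime_le fun t =>
      (hit_transfer_eq hp hij (le_antisymm hle hC.1) (by omega) t).ge) h.not_ge
  · exact expectedTime_lt hp (hit_transfer_le hp hij hle hn)
      (exists_hit_transfer_lt hp hij hle hn h)

lemma separatePayoff_transfer (hp : ∀ i, 0 < (p i).toReal) (hij : i ≠ j)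
    (hle : (p j).toReal ≤ (p i).toReal) (hn : n i < n j) {m : Fin k → ℕ}
    (hm : ∑ l, m l = ∑ l, n l) :
    separatePayoff p n m ≤ separatePayoff p (transfer n j i) m ∧
      (separatePayoff p n m < separatePayoff p (transfer n j i) m ↔
        (p j).toReal < (p i).toReal ∨ n i + 1 < n j) := by
  refine ⟨separatePayoff_le hp (hit_transfer_le hp hij hle hn) m, fun h => ?_, fun h => ?_⟩
  · by_contra hC
    push Not at hC
    exact absurd (separatePayoff_le hp (fun t =>
      (hit_transfer_eq hp hij (le_antisymm hle hC.1) (by omega) t).ge) m) h.not_ge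
  · refine separatePayoff_lt hp hij ?_ (hm.trans (sum_transfer n hij (by omega)).symm)
      (hit_transfer_le hp hij hle hn) (exists_hit_transfer_lt hp hij hle hn h)
    rintro rfl
    have := Finset.single_le_sum (fun i _ => Nat.zero_le (n i)) (Finset.mem_univ j)
    rw [← hm] at this
    simp at this
    omega

lemma separatePayoff_self (p : PMF (Fin k)) (n : Fin k → ℕ) : separatePayoff p n n = 0 := by
  linarith [separatePayoff_antisymm p n n]

lemma separatePayoff_transfer_self (hp : ∀ i, 0 < (p i).toReal) (hij : i ≠ j)
    (hle : (p j).toReal ≤ (p i).toReal) (hn : n i < n j) :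
    0 ≤ separatePayoff p (transfer n j i) n ∧
      (0 < separatePayoff p (transfer n j i) n ↔
        (p j).toReal < (p i).toReal ∨ n i + 1 < n j) := by
  have := separatePayoff_transfer hp hij hle hn (m := n) rfl
  rwa [separatePayoff_self] at this

end

/-! ### Nonincreasing allocations -/

lemma exists_antitone_dominating {p : PMF (Fin k)} (hp : ∀ i, 0 < (p i).toReal)
    (hmono : ∀ i j, i ≤ j → (p j).toReal ≤ (p i).toReal) (n : Fin k → ℕ) :
    ∃ n' ∈ strategies k (∑ l, n l), Antitone n' ∧ expectedTime p n' ≤ expectedTime p n ∧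
      ∀ m ∈ strategies k (∑ l, n l), separatePayoff p n m ≤ separatePayoff p n' m := by
  obtain ⟨n', h1, h2, h3, h4⟩ := exists_antitone_of_transfer
    (P := fun n' => n' ∈ strategies k (∑ l, n l) ∧ expectedTime p n' ≤ expectedTime p n ∧
      ∀ m ∈ strategies k (∑ l, n l), separatePayoff p n m ≤ separatePayoff p n' m)
    (fun c i j hc hij hlt => by
      refine ⟨(sum_transfer c hij.ne (by omega)).trans hc.1,
        (expectedTime_transfer hp hij.ne (hmono i j hij.le) hlt).1.trans hc.2.1,
        fun m hm => (hc.2.2 m hm).trans ?_⟩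
      exact (separatePayoff_transfer hp hij.ne (hmono i j hij.le) hlt
        (Eq.trans hm (Eq.symm hc.1))).1)
    n ⟨rfl, le_rfl, fun _ _ => le_rfl⟩
  exact ⟨n', h2, h1, h3, h4⟩

lemma exists_antitone_isFastest {p : PMF (Fin k)} (hp : ∀ i, 0 < (p i).toReal)
    (hmono : ∀ i j, i ≤ j → (p j).toReal ≤ (p i).toReal) (N : ℕ) :
    ∃ n, Antitone n ∧ IsFastest p N n := by
  obtain ⟨i, -⟩ := p.support_nonempty
  have hfin : (strategies k N).Finite := by
    refine (Set.finite_Iic (fun _ : Fin k => N)).subset fun n hn l => ?_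
    exact (Finset.single_le_sum (fun i _ => Nat.zero_le (n i)) (Finset.mem_univ l)).trans_eq hn
  have hne : (strategies k N).Nonempty :=
    ⟨Pi.single i N, (Finset.sum_pi_single' i N Finset.univ).trans (by simp)⟩
  obtain ⟨n, hn, hmin⟩ := Set.exists_min_image _ (expectedTime p) hfin hne
  obtain ⟨n', h1, h2, h3, -⟩ := exists_antitone_dominating hp hmono n
  exact ⟨n', h2, Eq.trans h1 hn, fun m hm => h3.trans (hmin m hm)⟩

lemma IsFastest.le_of_toReal_lt {p : PMF (Fin k)} (hp : ∀ i, 0 < (p i).toReal) {N : ℕ}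
    {n : Fin k → ℕ} (hn : IsFastest p N n) {i j : Fin k}
    (h : (p j).toReal < (p i).toReal) : n j ≤ n i := by
  by_contra hlt
  rw [not_le] at hlt
  have hij : i ≠ j := by
    rintro rfl
    exact lt_irrefl _ h
  have h1 := (expectedTime_transfer hp hij h.le hlt).2.2 (Or.inl h)
  exact absurd (hn.2 _ ((sum_transfer n hij (by omega)).trans hn.1)) h1.not_ge

/-! ### Pure optimal strategies -/

/-- Antisymmetry gives `V n n = 0` and makes the two saddle-point inequalities equivalent to one. -/
lemma isPureOptimal_iff {V : (Fin k → ℕ) → (Fin k → ℕ) → ℝ} (hV : ∀ n m, V n m = -V m n)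
    {N : ℕ} {n : Fin k → ℕ} :
    IsPureOptimal V N n ↔ n ∈ strategies k N ∧ ∀ m ∈ strategies k N, 0 ≤ V n m := by
  have h0 : V n n = 0 := by linarith [hV n n]
  refine and_congr_right fun hn => ⟨fun h m hm => ?_, fun h x hx y hy => ?_⟩
  · have := h m hm n hn
    change V n n ≤ V n m at this
    rwa [h0] at this
  · change V y n ≤ V n x
    have h1 := h x hx
    have h2 := h y hy
    have h3 := hV y n
    linarith

lemma IsPureOptimal.not_pos {V : (Fin k → ℕ) → (Fin k → ℕ) → ℝ} (hV : ∀ n m, V n m = -V m n)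
    {N : ℕ} {n m : Fin k → ℕ} (hn : IsPureOptimal V N n) (hm : m ∈ strategies k N) :
    ¬ 0 < V m n := by
  have h1 := ((isPureOptimal_iff hV).1 hn).2 m hm
  have h2 := hV n m
  linarith

lemma position_comp_swap (n : Fin k → ℕ) (i j : Fin k) (ω : ℕ → Fin k) (t : ℕ) :
    position (n ∘ Equiv.swap i j) ω t =
      position n (fun s => Equiv.swap i j (ω s)) t ∘ Equiv.swap i j := by
  induction t with
  | zero => rfl
  | succ t ih =>
    change step (position (n ∘ Equiv.swap i j) ω t) (ω t) =
      step (position n (fun s => Equiv.swap i j (ω s)) t) (Equiv.swap i j (ω t)) ∘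
        Equiv.swap i j
    rw [ih, ← step_comp_swap, Equiv.swap_apply_self]

lemma removalTime_comp_swap (n : Fin k → ℕ) (i j : Fin k) (ω : ℕ → Fin k) :
    removalTime (n ∘ Equiv.swap i j) ω = removalTime n (fun s => Equiv.swap i j (ω s)) := by
  unfold removalTime
  refine iInf_congr fun t => ?_
  have : position (n ∘ Equiv.swap i j) ω t = 0 ↔
      position n (fun s => Equiv.swap i j (ω s)) t = 0 := by
    rw [position_comp_swap]
    constructor
    · intro h
      funext l
      have := congrFun h (Equiv.swap i j l)
      simpa using this
    · intro h
      rw [h]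
      rfl
  simp only [this]

lemma map_swap_throws {p : PMF (Fin k)} {i j : Fin k} (hij : p i = p j) :
    (throws p).map (fun ω s => Equiv.swap i j (ω s)) = throws p := by
  unfold throws
  rw [Measure.infinitePi_map_pi _ (fun _ => Measurable.of_discrete)]
  congr 1
  funext _
  refine Measure.ext_of_singleton fun a => ?_
  rw [Measure.map_apply Measurable.of_discrete (measurableSet_singleton a)]
  have : (Equiv.swap i j) ⁻¹' {a} = {Equiv.swap i j a} := by
    ext b
    rw [Set.mem_preimage, Set.mem_singleton_iff, Set.mem_singleton_iff, ← Equiv.eq_symm_apply,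
      Equiv.symm_swap]
  rw [this, PMF.toMeasure_apply_singleton _ _ (measurableSet_singleton _),
    PMF.toMeasure_apply_singleton _ _ (measurableSet_singleton _)]
  exact congrFun (comp_swap_eq_self (c := p) hij) a

lemma measurableSet_removalTime_lt (n m : Fin k → ℕ) :
    MeasurableSet {ω | removalTime n ω < removalTime m ω} :=
  ((measurable_removalTime n).prodMk (measurable_removalTime m))
    (MeasurableSet.of_discrete (s := {x : ℕ∞ × ℕ∞ | x.1 < x.2}))

lemma commonPayoff_comp_swap {p : PMF (Fin k)} {i j : Fin k} (hij : p i = p j)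
    (n m : Fin k → ℕ) :
    commonPayoff p (n ∘ Equiv.swap i j) (m ∘ Equiv.swap i j) = commonPayoff p n m := by
  have key : ∀ n m : Fin k → ℕ, (throws p).real {ω | removalTime (n ∘ Equiv.swap i j) ω <
      removalTime (m ∘ Equiv.swap i j) ω} =
      (throws p).real {ω | removalTime n ω < removalTime m ω} := by
    intro n m
    conv_rhs => rw [← map_swap_throws hij]
    rw [measureReal_def, measureReal_def, Measure.map_apply ?_ (measurableSet_removalTime_lt n m)]
    · simp only [removalTime_comp_swap]
      rfl
    · exact measurable_pi_lambda _ fun s => Measurable.of_discrete.comp (measurable_pi_apply s)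
  unfold commonPayoff
  rw [key, key]

lemma transfer_eq_comp_swap {n : Fin k → ℕ} {i j : Fin k} (h : n i + 1 = n j) :
    transfer n j i = n ∘ Equiv.swap i j := by
  funext l
  rw [transfer, Function.comp_apply, Equiv.swap_apply_def, Function.update_apply,
    Function.update_apply]
  split_ifs <;> omega

/-- The common-throw comparison is only against `n` itself, so dominance is not at hand. Optimality
excludes a strict gain, which leaves only transfers that interchange two equally likely boxes, and
these preserve the game. -/
lemma IsPureOptimal.exists_antitone_common {p : PMF (Fin k)} (hp : ∀ i, 0 < (p i).toReal)
    (hmono : ∀ i j, i ≤ j → (p j).toReal ≤ (p i).toReal) {N : ℕ} {n : Fin k → ℕ}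
    (hn : IsPureOptimal (commonPayoff p) N n) :
    ∃ n', Antitone n' ∧ IsPureOptimal (commonPayoff p) N n' := by
  refine exists_antitone_of_transfer (fun n i j hn hij hlt => ?_) n hn
  have hmem : transfer n j i ∈ strategies k N :=
    (sum_transfer n hij.ne (by omega)).trans hn.1
  have h1 := (not_congr (commonPayoff_transfer hp hij.ne (hmono i j hij.le) hlt).2).1
    (hn.not_pos (commonPayoff_antisymm p) hmem)
  push Not at h1
  have hpij : p i = p j :=
    (ENNReal.toReal_eq_toReal_iff' (p.apply_ne_top i) (p.apply_ne_top j)).1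
      (le_antisymm h1.1 (hmono i j hij.le))
  have hsw : ∀ m : Fin k → ℕ, m = (m ∘ Equiv.swap i j) ∘ Equiv.swap i j := fun m => by
    funext l
    simp
  rw [isPureOptimal_iff (commonPayoff_antisymm p)] at hn ⊢
  refine ⟨hmem, fun m hm => ?_⟩
  rw [transfer_eq_comp_swap (by omega), hsw m, commonPayoff_comp_swap hpij]
  exact hn.2 _ ((Equiv.sum_comp (Equiv.swap i j) m).trans hm)

lemma IsPureOptimal.exists_antitone_separate {p : PMF (Fin k)} (hp : ∀ i, 0 < (p i).toReal)
    (hmono : ∀ i j, i ≤ j → (p j).toReal ≤ (p i).toReal) {N : ℕ} {n : Fin k → ℕ}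
    (hn : IsPureOptimal (separatePayoff p) N n) :
    ∃ n', Antitone n' ∧ IsPureOptimal (separatePayoff p) N n' := by
  rw [isPureOptimal_iff (separatePayoff_antisymm p)] at hn
  obtain ⟨rfl, hn⟩ := hn
  obtain ⟨n', h1, h2, -, h4⟩ := exists_antitone_dominating hp hmono n
  refine ⟨n', h2, (isPureOptimal_iff (separatePayoff_antisymm p)).2 ⟨h1, fun m hm => ?_⟩⟩
  exact (hn m hm).trans (h4 m hm)

lemma IsPureOptimal.le_of_toReal_lt {p : PMF (Fin k)}
    {V : (Fin k → ℕ) → (Fin k → ℕ) → ℝ} (hV : ∀ n m, V n m = -V m n)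
    (hVt : ∀ n i j, i ≠ j → (p j).toReal < (p i).toReal → n i < n j → 0 < V (transfer n j i) n)
    {N : ℕ} {n : Fin k → ℕ} (hn : IsPureOptimal V N n) {i j : Fin k}
    (h : (p j).toReal < (p i).toReal) : n j ≤ n i := by
  by_contra hlt
  rw [not_le] at hlt
  have hij : i ≠ j := by
    rintro rfl
    exact lt_irrefl _ h
  exact hn.not_pos hV ((sum_transfer n hij (by omega)).trans hn.1) (hVt n i j hij h hlt)

/-! ### The regularized incomplete beta function at positive integers -/

/-- The probability that, in independent trials with success probability `x`, success number `a`
comes before failure number `b`. -/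
noncomputable def successFirst (x : ℝ) : ℕ → ℕ → ℝ
  | 0, _ => 1
  | _ + 1, 0 => 0
  | a + 1, b + 1 => x * successFirst x a (b + 1) + (1 - x) * successFirst x (a + 1) b

lemma successFirst_zero_left (x : ℝ) (b : ℕ) : successFirst x 0 b = 1 := by
  rw [successFirst]

lemma successFirst_zero_right (x : ℝ) (a : ℕ) : successFirst x (a + 1) 0 = 0 := by
  rw [successFirst]

lemma successFirst_succ (x : ℝ) (a b : ℕ) : successFirst x (a + 1) (b + 1) =
    x * successFirst x a (b + 1) + (1 - x) * successFirst x (a + 1) b := by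
  rw [successFirst]

/-- Both terms concern the first `a + b` trials: at least `a` successes against at least `a + 1`.
The difference is the probability of exactly `a`. -/
lemma successFirst_sub (x : ℝ) (a b : ℕ) :
    successFirst x a (b + 1) - successFirst x (a + 1) b =
      ((a + b).factorial : ℝ) / (a.factorial * b.factorial) * (x ^ a * (1 - x) ^ b) := by
  induction a generalizing b with
  | zero =>
    induction b with
    | zero => simp [successFirst_zero_left, successFirst_zero_right]
    | succ b ih =>
      have hb : (b.factorial : ℝ) ≠ 0 := by positivity
      have hb' : ((b + 1).factorial : ℝ) ≠ 0 := by positivity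
      simp only [successFirst_zero_left, successFirst_succ, zero_add, Nat.factorial_zero,
        Nat.cast_one, one_mul, pow_zero, div_self hb, div_self hb'] at ih ⊢
      linear_combination (1 - x) * ih
  | succ a iha =>
    have ha : (a.factorial : ℝ) ≠ 0 := by positivity
    induction b with
    | zero =>
      have := iha 0
      simp only [successFirst_zero_right, successFirst_succ, zero_add, Nat.factorial_zero,
        Nat.cast_one, mul_one, pow_zero, add_zero, div_self ha,
        div_self (show ((a + 1).factorial : ℝ) ≠ 0 by positivity)] at this ⊢
      linear_combination x * this
    | succ b ihb =>
      have hb : (b.factorial : ℝ) ≠ 0 := by positivity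
      have h1 := iha (b + 1)
      rw [successFirst_succ x a (b + 1), successFirst_succ x (a + 1) b]
      have e1 : ((a + 1 + (b + 1)).factorial : ℝ) = (a + b + 2) * (a + b + 1).factorial := by
        rw [show a + 1 + (b + 1) = (a + b + 1) + 1 by ring, Nat.factorial_succ]
        push_cast; ring
      have e2 : a + (b + 1) = a + b + 1 := by ring
      have e3 : a + 1 + b = a + b + 1 := by ring
      have e4 : ((a + 1).factorial : ℝ) = (a + 1) * a.factorial := by
        rw [Nat.factorial_succ]; push_cast; ring
      have e5 : ((b + 1).factorial : ℝ) = (b + 1) * b.factorial := by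
        rw [Nat.factorial_succ]; push_cast; ring
      rw [e1, e4, e5]
      rw [e2, e5] at h1
      rw [e3, e4] at ihb
      have : ((a + b + 2 : ℝ) * (a + b + 1).factorial) /
          (((a + 1) * a.factorial) * ((b + 1) * b.factorial)) * (x ^ (a + 1) * (1 - x) ^ (b + 1)) =
          x * (((a + b + 1).factorial : ℝ) / (a.factorial * ((b + 1) * b.factorial)) *
            (x ^ a * (1 - x) ^ (b + 1))) +
          (1 - x) * (((a + b + 1).factorial : ℝ) / (((a + 1) * a.factorial) * b.factorial) *
            (x ^ (a + 1) * (1 - x) ^ b)) := by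
        field_simp
        ring
      rw [this, ← h1, ← ihb]
      ring

/-- Differentiating the recursion produces the binomial term of `successFirst_sub` besides the
derivatives already known; together they add up to the beta density. -/
lemma hasDerivAt_successFirst (x : ℝ) (a b : ℕ) :
    HasDerivAt (fun x => successFirst x (a + 1) (b + 1))
      (((a + b + 1).factorial : ℝ) / (a.factorial * b.factorial) * (x ^ a * (1 - x) ^ b)) x := by
  have key : ∀ (a b : ℕ) (f' g' : ℝ), HasDerivAt (fun x => successFirst x a (b + 1)) f' x →
      HasDerivAt (fun x => successFirst x (a + 1) b) g' x →
      HasDerivAt (fun x => successFirst x (a + 1) (b + 1))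
        (((a + b).factorial : ℝ) / (a.factorial * b.factorial) * (x ^ a * (1 - x) ^ b) +
          x * f' + (1 - x) * g') x := by
    intro a b f' g' hf hg
    simp only [successFirst_succ _ a b]
    rw [← successFirst_sub]
    refine (((hasDerivAt_id x).mul hf).add
      (((hasDerivAt_id x).const_sub 1).mul hg)).congr_deriv ?_
    simp only [id_eq]
    ring
  have hz : ∀ b, HasDerivAt (fun x => successFirst x 0 b) 0 x := fun b => by
    simpa only [successFirst_zero_left] using hasDerivAt_const x (1 : ℝ)
  have hr : ∀ a, HasDerivAt (fun x => successFirst x (a + 1) 0) 0 x := fun a => by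
    simpa only [successFirst_zero_right] using hasDerivAt_const x (0 : ℝ)
  have hf1 : ∀ n : ℕ, ((n + 1).factorial : ℝ) = (n + 1) * n.factorial := fun n => by
    rw [Nat.factorial_succ]; push_cast; ring
  have h0 : ∀ n : ℕ, (n.factorial : ℝ) ≠ 0 := fun n => by positivity
  induction a generalizing b with
  | zero =>
    induction b with
    | zero => exact (key 0 0 _ _ (hz _) (hr _)).congr_deriv (by simp)
    | succ b ih =>
      refine (key 0 (b + 1) _ _ (hz _) ih).congr_deriv ?_
      have := h0 b
      simp only [zero_add, hf1, Nat.factorial_zero]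
      push_cast
      field_simp
      ring
  | succ a iha =>
    induction b with
    | zero =>
      refine (key (a + 1) 0 _ _ (iha 0) (hr _)).congr_deriv ?_
      have := h0 a
      simp only [add_zero, hf1, Nat.factorial_zero]
      push_cast
      field_simp
      ring
    | succ b ihb =>
      refine (key (a + 1) (b + 1) _ _ (iha (b + 1)) ihb).congr_deriv ?_
      rw [show a + 1 + (b + 1) + 1 = (a + b + 1 + 1) + 1 by ring,
        show a + (b + 1) + 1 = a + b + 1 + 1 by ring, show a + 1 + b + 1 = a + b + 1 + 1 by ring,
        show a + 1 + (b + 1) = a + b + 1 + 1 by ring, hf1 (a + b + 1 + 1), hf1 a, hf1 b]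
      have h2 := h0 a
      have h3 := h0 b
      push_cast
      field_simp
      ring

lemma successFirst_at_zero (a b : ℕ) : successFirst 0 (a + 1) b = 0 := by
  induction b with
  | zero => rw [successFirst_zero_right]
  | succ b ih => rw [successFirst_succ, ih]; ring

lemma regIncBeta_eq_successFirst (x : ℝ) (a b : ℕ) :
    regIncBeta x (a + 1) (b + 1) = successFirst x (a + 1) (b + 1) := by
  have h1 : ∫ t in (0 : ℝ)..x, t ^ ((a + 1 : ℝ) - 1) * (1 - t) ^ ((b + 1 : ℝ) - 1) =
      ∫ t in (0 : ℝ)..x, t ^ a * (1 - t) ^ b := by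
    simp only [add_sub_cancel_right, Real.rpow_natCast]
  have h2 := intervalIntegral.integral_eq_sub_of_hasDerivAt (a := 0) (b := x)
    (fun t _ => hasDerivAt_successFirst t a b)
    (Continuous.intervalIntegrable (by fun_prop) _ _)
  rw [intervalIntegral.integral_const_mul, successFirst_at_zero, sub_zero] at h2
  rw [regIncBeta, h1, ← h2, Real.Gamma_nat_eq_factorial, Real.Gamma_nat_eq_factorial,
    ← Real.Gamma_nat_eq_factorial (a + b + 1)]
  congr 3
  push_cast
  ring

/-! ### Two boxes -/

section

variable {q : PMF (Fin 2)}

lemma step_pair_zero (a b : ℕ) : step ![a, b] 0 = ![a - 1, b] := by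
  funext l
  fin_cases l <;> simp [step_apply]

lemma step_pair_one (a b : ℕ) : step ![a, b] 1 = ![a, b - 1] := by
  funext l
  fin_cases l <;> simp [step_apply]

lemma real_removalTime_lt_add_real_lt (hq : ∀ i, 0 < (q i).toReal) {u : Fin 2 → ℕ}
    (hu : u ≠ 0) :
    (throws q).real {ω | removalTime (step u 1) ω < removalTime (step u 0) ω} +
      (throws q).real {ω | removalTime (step u 0) ω < removalTime (step u 1) ω} = 1 := by
  rw [← measureReal_union _ (measurableSet_removalTime_lt _ _),
    ← probReal_univ (μ := throws q)]
  · refine measureReal_congr (Filter.eventuallyEq_set.2 ?_)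
    filter_upwards [ae_removalTime_ne_top hq u] with ω hω
    simp only [Set.mem_univ, iff_true]
    obtain ⟨t, ht⟩ := exists_last_throw hu hω
    rcases Fin.exists_fin_two.1 ⟨ω t, rfl⟩ with h | h
    · exact Or.inr ((removalTime_step_lt_iff hu hω one_ne_zero).2 ⟨t, by rw [ht, h], h⟩)
    · exact Or.inl ((removalTime_step_lt_iff hu hω zero_ne_one).2 ⟨t, by rw [ht, h], h⟩)
  · rw [Set.disjoint_left]
    intro ω h1 h2
    rw [Set.mem_ofPred_eq] at h1 h2
    exact lt_asymm h1 h2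

/-- The last counter leaves box `1` when box `0` is emptied first, a throw of box `0` being a
success. The hypothesis `hab` excludes the corner where `successFirst` takes the value `1` by
convention. -/
lemma real_removalTime_lt_eq_successFirst (hq : ∀ i, 0 < (q i).toReal) (a b : ℕ)
    (hab : (![a, b] : Fin 2 → ℕ) ≠ 0) :
    (throws q).real {ω | removalTime (step ![a, b] 1) ω < removalTime (step ![a, b] 0) ω} =
      successFirst (q 0).toReal a b := by
  have hsum : (q 1).toReal = 1 - (q 0).toReal := by
    have := sum_toReal q
    rw [Fin.sum_univ_two] at this
    linarith
  induction hN : a + b using Nat.strong_induction_on generalizing a b with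
  | _ N ih =>
  rcases a with _ | a
  · have h1 := real_removalTime_lt_add_real_lt hq hab
    have h2 := hasSum_removalTime_step_lt hq hab (i := 1) (j := 0) (by simp)
    have h3 : ∀ t, (q 0).toReal * hit q t ![0, b] (Pi.single 0 1) = 0 := fun t => by
      rw [hit_single_eq_zero _ _ (by simp), mul_zero]
    simp only [h3] at h2
    rw [h2.unique hasSum_zero] at h1
    rw [successFirst_zero_left]
    linarith
  rcases b with _ | b
  · have h2 := hasSum_removalTime_step_lt hq hab (i := 0) (j := 1) (by simp)
    have h3 : ∀ t, (q 1).toReal * hit q t ![a + 1, 0] (Pi.single 1 1) = 0 := fun t => by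
      rw [hit_single_eq_zero _ _ (by simp), mul_zero]
    simp only [h3] at h2
    rw [h2.unique hasSum_zero, successFirst_zero_right]
  · have h0 : (![a, b + 1] : Fin 2 → ℕ) ≠ 0 := fun h => by simpa using congrFun h 1
    have h1 : (![a + 1, b] : Fin 2 → ℕ) ≠ 0 := fun h => by simpa using congrFun h 0
    have hne : (![a + 1, b + 1] : Fin 2 → ℕ) ≠ Pi.single 1 1 := fun h => by
      simpa using congrFun h 0
    have e0 := ih _ (by omega) a (b + 1) h0 rfl
    have e1 := ih _ (by omega) (a + 1) b h1 rfl
    have s := hasSum_removalTime_step_lt hq hab (i := 0) (j := 1) (by simp)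
    have s0 := hasSum_removalTime_step_lt hq h0 (i := 0) (j := 1) (by simp)
    have s1 := hasSum_removalTime_step_lt hq h1 (i := 0) (j := 1) (by simp)
    rw [e0] at s0
    rw [e1] at s1
    have s' := ((s0.mul_left (q 0).toReal).add (s1.mul_left (q 1).toReal))
    -- The term for `t = 0` vanishes, as both boxes are nonempty; the shifted terms are expanded by
    -- the first throw.
    rw [← hasSum_nat_add_iff' 1] at s
    simp only [Finset.range_one, Finset.sum_singleton, hit_zero, if_neg hne, mul_zero, sub_zero,
      hit_succ, Fin.sum_univ_two, step_pair_zero, step_pair_one, Nat.add_sub_cancel] at s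
    rw [successFirst_succ, ← hsum]
    simp only [step_pair_zero, step_pair_one, Nat.add_sub_cancel]
    refine s.unique ?_
    have h : ∀ t, (q 0).toReal * ((q 1).toReal * hit q t ![a, b + 1] (Pi.single 1 1)) +
        (q 1).toReal * ((q 1).toReal * hit q t ![a + 1, b] (Pi.single 1 1)) =
        (q 1).toReal * ((q 0).toReal * hit q t ![a, b + 1] (Pi.single 1 1) +
          (q 1).toReal * hit q t ![a + 1, b] (Pi.single 1 1)) := fun t => by ring
    simpa only [h] using s'

/-! ### The expected margin of victory -/

lemma toReal_toENNReal (x : ℕ∞) : (x : ℝ≥0∞).toReal = (x.toNat : ℝ) := by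
  induction x using ENat.recTopCoe with
  | top => simp
  | coe n => simp

lemma integrable_toNat_removalTime {p : PMF (Fin k)} (hp : ∀ i, 0 < (p i).toReal)
    (n : Fin k → ℕ) :
    Integrable (fun ω => ((removalTime n ω).toNat : ℝ)) (throws p) := by
  simp only [← toReal_toENNReal]
  exact integrable_toReal_of_lintegral_ne_top
    (Measurable.of_discrete.comp (measurable_removalTime n)).aemeasurable
    (expectedTime_lt_top hp n).ne

lemma integral_toNat_removalTime {p : PMF (Fin k)} (hp : ∀ i, 0 < (p i).toReal)
    (n : Fin k → ℕ) :
    ∫ ω, ((removalTime n ω).toNat : ℝ) ∂(throws p) = (expectedTime p n).toReal := by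
  have hm : Measurable fun ω => ((removalTime n ω : ℕ∞) : ℝ≥0∞) :=
    Measurable.of_discrete.comp (measurable_removalTime n)
  simp only [← toReal_toENNReal]
  exact integral_toReal hm.aemeasurable (ae_lt_top hm (expectedTime_lt_top hp n).ne)

lemma integrable_margin {p : PMF (Fin k)} (hp : ∀ i, 0 < (p i).toReal) (n m : Fin k → ℕ) :
    Integrable (margin n m) (throws p) :=
  (integrable_toNat_removalTime hp m).sub (integrable_toNat_removalTime hp n)

lemma integral_margin {p : PMF (Fin k)} (hp : ∀ i, 0 < (p i).toReal) (n m : Fin k → ℕ) :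
    ∫ ω, margin n m ω ∂(throws p) = (expectedTime p m).toReal - (expectedTime p n).toReal := by
  rw [← integral_toNat_removalTime hp, ← integral_toNat_removalTime hp]
  exact integral_sub (integrable_toNat_removalTime hp m) (integrable_toNat_removalTime hp n)

lemma toReal_expectedTime {p : PMF (Fin k)} (hp : ∀ i, 0 < (p i).toReal) (n : Fin k → ℕ) :
    (expectedTime p n).toReal = ∑' t : ℕ, (1 - hit p t n 0) := by
  rw [expectedTime_eq_ofReal hp, ENNReal.toReal_ofReal
    (tsum_nonneg fun _ => sub_nonneg.2 (hit_le_one _ _ _ _))]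

/-- The expected margin of victory in terms of the box that provides the last counter. -/
lemma integral_margin_step {p : PMF (Fin k)} (hp : ∀ i, 0 < (p i).toReal) {u : Fin k → ℕ}
    (hu : u ≠ 0) {i j : Fin k} (hij : i ≠ j) :
    ∫ ω, margin (step u j) (step u i) ω ∂(throws p) =
      (throws p).real {ω | removalTime (step u j) ω < removalTime (step u i) ω} / (p j).toReal -
      (throws p).real {ω | removalTime (step u i) ω < removalTime (step u j) ω} /
        (p i).toReal := by
  rw [integral_margin hp, toReal_expectedTime hp, toReal_expectedTime hp]
  have h1 := (summable_one_sub_hit hp (step u i)).hasSum.sub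
    (summable_one_sub_hit hp (step u j)).hasSum
  have h2 := ((hasSum_removalTime_step_lt hp hu hij).div_const (p j).toReal).sub
    ((hasSum_removalTime_step_lt hp hu hij.symm).div_const (p i).toReal)
  refine h1.unique ?_
  -- Both series have the terms `hit p t u e_j - hit p t u e_i`: the expected number of throws spent
  -- waiting with one counter in box `j`, minus the same for box `i`.
  convert h2 using 1
  funext t
  rw [mul_div_cancel_left₀ _ (hp j).ne', mul_div_cancel_left₀ _ (hp i).ne',
    hit_step_zero_right, hit_step_zero_right]
  ring

lemma margin_pos_iff {n m : Fin k → ℕ} {ω : ℕ → Fin k} (hn : removalTime n ω ≠ ⊤)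
    (hm : removalTime m ω ≠ ⊤) : 0 < margin n m ω ↔ removalTime n ω < removalTime m ω := by
  obtain ⟨r, hr⟩ := ENat.ne_top_iff_exists.1 hn
  obtain ⟨s, hs⟩ := ENat.ne_top_iff_exists.1 hm
  rw [margin, ← hr, ← hs, sub_pos]
  simp

lemma real_margin_pos {p : PMF (Fin k)} (hp : ∀ i, 0 < (p i).toReal) (n m : Fin k → ℕ) :
    (throws p).real {ω | 0 < margin n m ω} =
      (throws p).real {ω | removalTime n ω < removalTime m ω} := by
  refine measureReal_congr (Filter.eventuallyEq_set.2 ?_)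
  filter_upwards [ae_removalTime_ne_top hp n, ae_removalTime_ne_top hp m] with ω h1 h2
  exact margin_pos_iff h1 h2

lemma ae_margin_ne_zero (hq : ∀ i, 0 < (q i).toReal) {u : Fin 2 → ℕ} (hu : u ≠ 0) :
    ∀ᵐ ω ∂(throws q), removalTime (step u 1) ω ≠ ⊤ ∧ removalTime (step u 0) ω ≠ ⊤ ∧
      margin (step u 1) (step u 0) ω ≠ 0 := by
  filter_upwards [ae_removalTime_ne_top hq u, ae_removalTime_ne_top hq (step u 1),
    ae_removalTime_ne_top hq (step u 0)] with ω hω h1 h0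
  refine ⟨h1, h0, ?_⟩
  obtain ⟨t, ht⟩ := exists_last_throw hu hω
  rcases Fin.exists_fin_two.1 ⟨ω t, rfl⟩ with h | h
  · have := (margin_pos_iff h0 h1).2
      ((removalTime_step_lt_iff hu hω one_ne_zero).2 ⟨t, by rw [ht, h], h⟩)
    unfold margin at this ⊢
    linarith
  · exact ((margin_pos_iff h1 h0).2
      ((removalTime_step_lt_iff hu hω zero_ne_one).2 ⟨t, by rw [ht, h], h⟩)).ne'

end

end LiabilityGame

/-! ### The main theorem -/

theorem mainTheorem3 :
    -- Part 1: any number of boxes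
    (∀ (k : ℕ) (p : PMF (Fin k)), (∀ i, 0 < p i) → (∀ i j, i ≤ j → p j ≤ p i) →
      -- all removal times have finite expectation
      (∀ n : Fin k → ℕ, LiabilityGame.expectedTime p n < ⊤) ∧
      -- the effect of a single transfer towards the likelier box
      (∀ (n : Fin k → ℕ) (i j : Fin k), i < j → n i < n j →
        (LiabilityGame.expectedTime p (LiabilityGame.transfer n j i)
            ≤ LiabilityGame.expectedTime p n ∧
          (LiabilityGame.expectedTime p (LiabilityGame.transfer n j i)
            < LiabilityGame.expectedTime p n ↔ p j < p i ∨ n i + 1 < n j)) ∧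
        (0 ≤ LiabilityGame.commonPayoff p (LiabilityGame.transfer n j i) n ∧
          (0 < LiabilityGame.commonPayoff p (LiabilityGame.transfer n j i) n ↔
            p j < p i ∨ n i + 1 < n j)) ∧
        (0 ≤ LiabilityGame.separatePayoff p (LiabilityGame.transfer n j i) n ∧
          (0 < LiabilityGame.separatePayoff p (LiabilityGame.transfer n j i) n ↔
            p j < p i ∨ n i + 1 < n j)) ∧
        (∀ m ∈ LiabilityGame.strategies k (∑ l, n l),
          LiabilityGame.separatePayoff p n m
            ≤ LiabilityGame.separatePayoff p (LiabilityGame.transfer n j i) m ∧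
          (LiabilityGame.separatePayoff p n m
            < LiabilityGame.separatePayoff p (LiabilityGame.transfer n j i) m ↔
            p j < p i ∨ n i + 1 < n j))) ∧
      -- only nonincreasing allocations need be considered
      (∀ n : Fin k → ℕ, ∃ n' ∈ LiabilityGame.strategies k (∑ l, n l), Antitone n' ∧
        LiabilityGame.expectedTime p n' ≤ LiabilityGame.expectedTime p n ∧
        ∀ m ∈ LiabilityGame.strategies k (∑ l, n l),
          LiabilityGame.separatePayoff p n m ≤ LiabilityGame.separatePayoff p n' m) ∧
      (∀ N : ℕ, ∃ n, Antitone n ∧ LiabilityGame.IsFastest p N n) ∧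
      (∀ (N : ℕ) (n : Fin k → ℕ), LiabilityGame.IsFastest p N n →
        ∀ i j, p j < p i → n j ≤ n i) ∧
      (∀ V ∈ ({LiabilityGame.commonPayoff p, LiabilityGame.separatePayoff p} :
          Set ((Fin k → ℕ) → (Fin k → ℕ) → ℝ)),
        ∀ (N : ℕ) (n : Fin k → ℕ), LiabilityGame.IsPureOptimal V N n →
          (∀ i j, p j < p i → n j ≤ n i) ∧
          ∃ n', Antitone n' ∧ LiabilityGame.IsPureOptimal V N n')) ∧
    -- Part 2: the margin of victory with two boxes and common throws
    (∀ (q : PMF (Fin 2)) (x : ℝ), 0 < x → x < 1 → q 0 = ENNReal.ofReal x → ∀ a b : ℕ,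
      (∀ᵐ ω ∂(LiabilityGame.throws q), LiabilityGame.removalTime ![a + 1, b] ω ≠ ⊤ ∧
        LiabilityGame.removalTime ![a, b + 1] ω ≠ ⊤ ∧
        LiabilityGame.margin ![a + 1, b] ![a, b + 1] ω ≠ 0) ∧
      (LiabilityGame.throws q).real {ω | 0 < LiabilityGame.margin ![a + 1, b] ![a, b + 1] ω}
        = LiabilityGame.regIncBeta x (a + 1) (b + 1) ∧
      MeasureTheory.Integrable (LiabilityGame.margin ![a + 1, b] ![a, b + 1])
        (LiabilityGame.throws q) ∧
      ∫ ω, LiabilityGame.margin ![a + 1, b] ![a, b + 1] ω ∂(LiabilityGame.throws q)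
        = LiabilityGame.regIncBeta x (a + 1) (b + 1) / (1 - x)
          - (1 - LiabilityGame.regIncBeta x (a + 1) (b + 1)) / x ∧
      (1 / 2 ≤ x → a ≤ b → (1 / 2 < x ∨ a < b) →
        0 < ∫ ω, LiabilityGame.margin ![a + 1, b] ![a, b + 1] ω ∂(LiabilityGame.throws q))) := by
  refine ⟨fun k p hpos hmono' => ?_, fun q x hx0 hx1 hqx a b => ?_⟩
  · have hp : ∀ i, 0 < (p i).toReal := fun i =>
      ENNReal.toReal_pos (hpos i).ne' (p.apply_ne_top i)
    have hlt : ∀ i j, (p j).toReal < (p i).toReal ↔ p j < p i := fun i j =>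
      ENNReal.toReal_lt_toReal (p.apply_ne_top j) (p.apply_ne_top i)
    have hmono : ∀ i j, i ≤ j → (p j).toReal ≤ (p i).toReal := fun i j hij =>
      ENNReal.toReal_mono (p.apply_ne_top i) (hmono' i j hij)
    refine ⟨LiabilityGame.expectedTime_lt_top hp, fun n i j hij hn => ?_,
      LiabilityGame.exists_antitone_dominating hp hmono,
      LiabilityGame.exists_antitone_isFastest hp hmono,
      fun N n hn i j h => hn.le_of_toReal_lt hp ((hlt i j).2 h), ?_⟩
    · have hle := hmono i j hij.le
      simp only [← hlt]
      exact ⟨LiabilityGame.expectedTime_transfer hp hij.ne hle hn,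
        LiabilityGame.commonPayoff_transfer hp hij.ne hle hn,
        LiabilityGame.separatePayoff_transfer_self hp hij.ne hle hn,
        fun m hm => LiabilityGame.separatePayoff_transfer hp hij.ne hle hn hm⟩
    · rintro V (rfl | rfl) N n hn
      · refine ⟨fun i j h => hn.le_of_toReal_lt (LiabilityGame.commonPayoff_antisymm p) ?_
          ((hlt i j).2 h), hn.exists_antitone_common hp hmono⟩
        exact fun n i j hij h hn =>
          (LiabilityGame.commonPayoff_transfer hp hij h.le hn).2.2 (Or.inl h)
      · refine ⟨fun i j h => hn.le_of_toReal_lt (LiabilityGame.separatePayoff_antisymm p) ?_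
          ((hlt i j).2 h), hn.exists_antitone_separate hp hmono⟩
        exact fun n i j hij h hn =>
          (LiabilityGame.separatePayoff_transfer_self hp hij h.le hn).2.2 (Or.inl h)
  · have hq0 : (q 0).toReal = x := by rw [hqx, ENNReal.toReal_ofReal hx0.le]
    have hq1 : (q 1).toReal = 1 - x := by
      have := LiabilityGame.sum_toReal q
      rw [Fin.sum_univ_two] at this
      linarith
    have hq : ∀ i, 0 < (q i).toReal := by
      intro i
      fin_cases i
      · exact hx0.trans_eq hq0.symm
      · exact (sub_pos.2 hx1).trans_eq hq1.symm
    have hu : (![a + 1, b + 1] : Fin 2 → ℕ) ≠ 0 := fun h => by simpa using congrFun h 0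
    have hs1 : LiabilityGame.step ![a + 1, b + 1] 1 = ![a + 1, b] :=
      LiabilityGame.step_pair_one _ _
    have hs0 : LiabilityGame.step ![a + 1, b + 1] 0 = ![a, b + 1] :=
      LiabilityGame.step_pair_zero _ _
    have hI := LiabilityGame.real_removalTime_lt_eq_successFirst hq _ _ hu
    have hadd := LiabilityGame.real_removalTime_lt_add_real_lt hq hu
    have hM := LiabilityGame.integral_margin_step hq hu (i := 0) (j := 1) zero_ne_one
    have hae := LiabilityGame.ae_margin_ne_zero hq hu
    rw [hq0, ← LiabilityGame.regIncBeta_eq_successFirst] at hI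
    rw [hI] at hM hadd
    rw [eq_sub_of_add_eq' hadd, hq0, hq1] at hM
    rw [hs1, hs0] at hI hM hae
    refine ⟨hae, by rw [LiabilityGame.real_margin_pos hq, hI],
      LiabilityGame.integrable_margin hq _ _, hM, fun hx hab h => ?_⟩
    -- The sign needs no estimate of the beta function: player I's allocation is a transfer of
    -- player II's towards the likelier box, and the strict comparison of expected times applies.
    have ht : LiabilityGame.transfer ![a, b + 1] 1 0 = ![a + 1, b] := by
      funext l
      fin_cases l <;> simp [LiabilityGame.transfer]
    have hlt := (LiabilityGame.expectedTime_transfer hq (i := 0) (j := 1) (n := ![a, b + 1])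
      zero_ne_one (by rw [hq0, hq1]; linarith)
      (by simpa using Nat.lt_succ_of_le hab)).2.2 (by
        rw [hq0, hq1]
        rcases h with h | h
        · left; linarith
        · right; simpa using h)
    rw [ht] at hlt
    rw [LiabilityGame.integral_margin hq, sub_pos]
    exact (ENNReal.toReal_lt_toReal (LiabilityGame.expectedTime_lt_top hq _).ne
      (LiabilityGame.expectedTime_lt_top hq _).ne).2 hlt
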